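/- \textbf{Setting.} Let $\mathsf{AP}$ be a finite set of atomic propositions. A \emph{trace} over $2^{\mathsf{AP}}$ is a finite sequence of events $(\sigma_1,\tau_1)\dots(\sigma_n,\tau_n)$ with $\sigma_i\subseteq \mathsf{AP}$ and $0\le\tau_1<\dots<\tau_n$ real. A \emph{timed automaton} $\mathcal A$ over $2^{\mathsf{AP}}$ has finitely many locations, one initial location, finitely many clocks, a finite set of transitions (each with a label in $2^{\mathsf{AP}}$, a guard built by conjunction from $\top$ and $x\bowtie c$ with $x$ a clock, $\bowtie\in\{\le,<,\ge,>\}$, $c\in\mathbb N$, and a set of clocks to reset) and a set of accepting locations; $[\![\mathcal A]\!]$ is the set of traces that it accepts. \emph{HyperMTL} formulae over $\mathsf{AP}$ are given by $$\varphi ::= \exists\pi\,\varphi\mid\forall\pi\,\varphi\mid\psi,\qquad \psi ::= \top\mid\top_\pi\mid p_\pi\mid\psi_1\wedge\psi_2\mid\neg\psi\mid\psi_1\,\mathbf U_I\,\psi_2\mid\psi_1\,\mathbf S_I\,\psi_2,$$ with $\pi$ a trace variable, $p\in\mathsf{AP}$, and $I\subseteq\mathbb R_{\ge0}$ a non-singular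 interval with endpoints in $\mathbb N\cup\{\infty\}$; each quantifier uses a fresh variable. The semantics is pointwise, with strict until and since: at a time $t\ge 0$, $\top$ holds iff some assigned trace has an event at $t$; $\top_\pi$ iff the trace of $\pi$ does; $p_\pi$ ($\neg p_\pi$) iff the trace of $\pi$ has an event at $t$ whose label contains (does not contain) $p$; all other negations are evaluated by pushing them to the atoms, with dual operators for $\mathbf U_I$ and $\mathbf S_I$. A closed formula is evaluated at time $0$. In the \emph{synchronous} semantics, written $T\models^{\mathrm{sync}}\varphi$ for a set $T$ of traces, each quantifier ranges over those traces of $T$ that have exactly the same timestamps as all traces assigned so far. The synchronous \emph{model-checking problem} asks, given a timed automaton $\mathcal A$ over $2^{\mathsf{AP}}$ and a closed HyperMTL formula $\varphi$ over $\mathsf{AP}$ (both coded effectively as natural numbers, $\mathsf{AP}$ being part of the input), whether $[\![\mathcal A]\!]\models^{\mathrm{sync}}\varphi$. \textbf{Theorem.} In the synchronous semantics, model checking is undecidable for $\exists^*\forall^*$-HyperMTL and for $\forall^*\exists^*$-HyperMTL, i.e. for closed formulae with quantifier pattern $\exists^i\forall^j$, respectively $\forall^i\exists^j$, $i,j\ge0$.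 Moreover, it remains undecidable for formulae with quantifier pattern exactly $\exists\forall\forall$, and for formulae with quantifier pattern exactly $\forall\exists\exists$, when the instances are restricted as follows. 1. The quantifier-free part of the formula is untimed LTL: it has no since operator, and all its intervals are $[0,\infty)$. 2. The automaton has exactly one clock; no guard is satisfied by exactly one clock value; and every transition with a guard other than $\top$ resets the clock. 3. The automaton has stuttering self-loops: for some $p^\epsilon\in \mathsf{AP}$, the initial location, every accepting location, and every location entered by a transition that resets the clock have a self-loop with label $\{p^\epsilon\}$, guard $\top$ and no reset, and $p^\epsilon$ occurs in the label of no transition other than such self-loops. -/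

import Mathlib

open scoped NNReal

namespace HyperMTL

/-! ### Traces -/

/-- A letter of the alphabet `2^AP`, where `AP = {0, …, m - 1}`. -/
abbrev Letter (m : ℕ) : Type := Finset (Fin m)

/-- A finite timed word (trace) over `2^AP` with strictly increasing timestamps. -/
structure Trace (m : ℕ) where
  events : List (Letter m × ℝ≥0)
  increasing : events.Pairwise (fun a b => a.2 < b.2)

/-- `t ∈ ρ`: some event of `ρ` has timestamp `t`. -/
def Trace.HasTime {m : ℕ} (ρ : Trace m) (t : ℝ≥0) : Prop :=
  ∃ σ, (σ, t) ∈ ρ.events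

/-- `ρ` has an event at time `t` and proposition `p` holds there. -/
def Trace.Holds {m : ℕ} (ρ : Trace m) (t : ℝ≥0) (p : Fin m) : Prop :=
  ∃ σ, (σ, t) ∈ ρ.events ∧ p ∈ σ

/-- `ρ` has an event at time `t` and proposition `p` does not hold there. -/
def Trace.Fails {m : ℕ} (ρ : Trace m) (t : ℝ≥0) (p : Fin m) : Prop :=
  ∃ σ, (σ, t) ∈ ρ.events ∧ p ∉ σ

/-! ### Timed automata -/

inductive CmpOp where
  | le
  | lt
  | ge
  | gt

def CmpOp.Sat : CmpOp → ℝ≥0 → ℝ≥0 → Prop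
  | .le, a, c => a ≤ c
  | .lt, a, c => a < c
  | .ge, a, c => a ≥ c
  | .gt, a, c => a > c

/-- Clock constraints over the clocks `Fin k`. -/
inductive Guard (k : ℕ) where
  | top : Guard k
  | and : Guard k → Guard k → Guard k
  | cmp : Fin k → CmpOp → ℕ → Guard k

abbrev Valuation (k : ℕ) : Type := Fin k → ℝ≥0

def Guard.Sat {k : ℕ} (v : Valuation k) : Guard k → Prop
  | .top => True
  | .and g h => g.Sat v ∧ h.Sat v
  | .cmp x op c => op.Sat (v x) (c : ℝ≥0)

/-- The valuation `v + d`. -/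
def Valuation.delay {k : ℕ} (v : Valuation k) (d : ℝ≥0) : Valuation k :=
  fun x => v x + d

/-- The valuation `v[L ← 0]`. -/
def Valuation.reset {k : ℕ} (v : Valuation k) (L : Finset (Fin k)) : Valuation k :=
  fun x => if x ∈ L then 0 else v x

/-- Transitions of a timed automaton over `2^AP` with locations `Fin n` and clocks `Fin k`. -/
structure Transition (m n k : ℕ) where
  src : Fin n
  label : Letter m
  guard : Guard k
  reset : Finset (Fin k)
  dst : Fin n

/-- Timed automata over `2^AP`, `AP = Fin m`. The (finite) transition relation is the set of
members of the list `trans`. -/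
structure TimedAutomaton (m : ℕ) where
  nLoc : ℕ
  nClk : ℕ
  init : Fin nLoc
  trans : List (Transition m nLoc nClk)
  accepting : Finset (Fin nLoc)

namespace TimedAutomaton

variable {m : ℕ} (A : TimedAutomaton m)

/-- A state `(s, v)`. -/
abbrev State : Type := Fin A.nLoc × Valuation A.nClk

/-- `A.Run t q w q'`: being in state `q` at time `t`, the automaton can read the timed word `w`
and end in state `q'`. -/
inductive Run : ℝ≥0 → A.State → List (Letter m × ℝ≥0) → A.State → Prop
  | nil (t : ℝ≥0) (q : A.State) : Run t q [] q
  | cons (t t' : ℝ≥0) (v : Valuation A.nClk) (e : Transition m A.nLoc A.nClk)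
      (w : List (Letter m × ℝ≥0)) (q' : A.State)
      (mem : e ∈ A.trans)
      (guard : e.guard.Sat (v.delay (t' - t)))
      (rest : Run t' (e.dst, (v.delay (t' - t)).reset e.reset) w q') :
      Run t (e.src, v) ((e.label, t') :: w) q'

/-- `A` has an accepting run on `ρ` (all clocks are initially `0`, and the initial time is `0`). -/
def Accepts (ρ : Trace m) : Prop :=
  ∃ q : A.State, A.Run 0 (A.init, fun _ => 0) ρ.events q ∧ q.1 ∈ A.accepting

/-- The timed language of `A`. -/
def language : Set (Trace m) := {ρ | A.Accepts ρ}

/-- `A` has exactly one clock. -/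
def OneClock : Prop := A.nClk = 1

/-- All guards are non-singular. -/
def NonSingular : Prop :=
  ∀ e ∈ A.trans, ¬ ∃ v : Valuation A.nClk, ∀ w : Valuation A.nClk, e.guard.Sat w ↔ w = v

/-- Transitions with a guard other than `⊤` reset all clocks (that is, the single clock of a
one-clock automaton). -/
def ResetOnTesting : Prop :=
  ∀ e ∈ A.trans, e.guard ≠ Guard.top → ∀ x, x ∈ e.reset

/-- The stuttering self-loop at `s`, labelled with `{ε}`. -/
def stutterLoop (ε : Fin m) (s : Fin A.nLoc) : Transition m A.nLoc A.nClk :=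
  ⟨s, {ε}, Guard.top, ∅, s⟩

/-- For some proposition `ε`, the initial location, all accepting locations and all
locations that are entered by a transition resetting a clock carry a stuttering self-loop labelled
with `{ε}`; and `ε` occurs on no other transitions than stuttering self-loops. -/
def HasStutterLoops : Prop :=
  ∃ ε : Fin m,
    (∀ s : Fin A.nLoc,
      (s = A.init ∨ s ∈ A.accepting ∨ ∃ e ∈ A.trans, e.dst = s ∧ e.reset.Nonempty) →
        A.stutterLoop ε s ∈ A.trans) ∧
    ∀ e ∈ A.trans, ε ∈ e.label → e = A.stutterLoop ε e.src

end TimedAutomaton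

/-! ### Formulae -/

/-- Nonempty non-singular intervals of `ℝ≥0` with endpoints in `ℕ ∪ {∞}`. The Booleans tell
whether the endpoints are included; `hi = none` stands for the upper endpoint `∞`. -/
structure TimeInterval where
  lo : ℕ
  loClosed : Bool
  hi : Option (ℕ × Bool)
  nondegenerate : ∀ u ∈ hi, lo < u.1

/-- Membership in an interval. -/
def TimeInterval.Mem (I : TimeInterval) (d : ℝ≥0) : Prop :=
  (if I.loClosed then (I.lo : ℝ≥0) ≤ d else (I.lo : ℝ≥0) < d) ∧
    ∀ u ∈ I.hi, if u.2 then d ≤ (u.1 : ℝ≥0) else d < (u.1 : ℝ≥0)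

/-- The interval `[0, ∞)`. -/
def TimeInterval.full : TimeInterval := ⟨0, true, none, by simp⟩

/-- Quantifier-free formulae; trace variables are natural numbers. -/
inductive QFree (m : ℕ) where
  | top : QFree m
  | topOf (π : ℕ) : QFree m
  | atom (p : Fin m) (π : ℕ) : QFree m
  | and (ψ₁ ψ₂ : QFree m) : QFree m
  | neg (ψ : QFree m) : QFree m
  | untl (I : TimeInterval) (ψ₁ ψ₂ : QFree m) : QFree m
  | snce (I : TimeInterval) (ψ₁ ψ₂ : QFree m) : QFree m

/-- HyperMTL formulae. -/
inductive Formula (m : ℕ) where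
  | ex (π : ℕ) (φ : Formula m) : Formula m
  | all (π : ℕ) (φ : Formula m) : Formula m
  | qfree (ψ : QFree m) : Formula m

/-- The trace variables of a quantifier-free formula. -/
def QFree.vars {m : ℕ} : QFree m → Finset ℕ
  | .top => ∅
  | .topOf π => {π}
  | .atom _ π => {π}
  | .and ψ₁ ψ₂ => ψ₁.vars ∪ ψ₂.vars
  | .neg ψ => ψ.vars
  | .untl _ ψ₁ ψ₂ => ψ₁.vars ∪ ψ₂.vars
  | .snce _ ψ₁ ψ₂ => ψ₁.vars ∪ ψ₂.vars

/-- Untimed LTL: no past operators, and all constraining intervals are `[0, ∞)`. -/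
def QFree.IsLTL {m : ℕ} : QFree m → Prop
  | .top => True
  | .topOf _ => True
  | .atom _ _ => True
  | .and ψ₁ ψ₂ => ψ₁.IsLTL ∧ ψ₂.IsLTL
  | .neg ψ => ψ.IsLTL
  | .untl I ψ₁ ψ₂ => I = TimeInterval.full ∧ ψ₁.IsLTL ∧ ψ₂.IsLTL
  | .snce _ _ _ => False

inductive Quant where
  | ex
  | all

namespace Formula

variable {m : ℕ}

def freeVars : Formula m → Finset ℕ
  | .ex π φ => φ.freeVars.erase π
  | .all π φ => φ.freeVars.erase π
  | .qfree ψ => ψ.vars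

/-- The quantified trace variables, in order. -/
def boundVars : Formula m → List ℕ
  | .ex π φ => π :: φ.boundVars
  | .all π φ => π :: φ.boundVars
  | .qfree _ => []

/-- The quantifier pattern. -/
def pattern : Formula m → List Quant
  | .ex _ φ => Quant.ex :: φ.pattern
  | .all _ φ => Quant.all :: φ.pattern
  | .qfree _ => []

/-- The quantifier-free part. -/
def body : Formula m → QFree m
  | .ex _ φ => φ.body
  | .all _ φ => φ.body
  | .qfree ψ => ψ

/-- Closed, with every quantifier using a fresh trace variable. -/
def Closed (φ : Formula m) : Prop := φ.freeVars = ∅ ∧ φ.boundVars.Nodup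

/-- The `∃*∀*` fragment. -/
def IsExistsForall (φ : Formula m) : Prop :=
  ∃ i j : ℕ, φ.pattern = List.replicate i Quant.ex ++ List.replicate j Quant.all

/-- The `∀*∃*` fragment. -/
def IsForallExists (φ : Formula m) : Prop :=
  ∃ i j : ℕ, φ.pattern = List.replicate i Quant.all ++ List.replicate j Quant.ex

end Formula

/-! ### Semantics -/

/-- Trace assignments: partial maps from trace variables to traces. -/
abbrev Assignment (m : ℕ) : Type := ℕ → Option (Trace m)

/-- `⊤` at time `t`: some assigned trace has an event at `t`. -/
def Assignment.HasTime {m : ℕ} (V : Assignment m) (t : ℝ≥0) : Prop :=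
  ∃ π, ∃ ρ ∈ V π, ρ.HasTime t

/-- Pointwise satisfaction of quantifier-free formulae. As negation is interpreted through the
negation normal form, the definition carries a polarity: `ψ.Sat V true t` is satisfaction
of `ψ`, and `ψ.Sat V false t` is satisfaction of the negation normal form of `¬ ψ`. In
particular both `p_π` and `¬ p_π` require that the trace of `π` has an event at `t`, and the
negations of until and since are the dual operators. -/
def QFree.Sat {m : ℕ} (V : Assignment m) : QFree m → Bool → ℝ≥0 → Prop
  | .top, true, t => V.HasTime t
  | .top, false, t => ¬ V.HasTime t
  | .topOf π, true, t => ∃ ρ ∈ V π, ρ.HasTime t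
  | .topOf π, false, t => ∃ ρ ∈ V π, ¬ ρ.HasTime t
  | .atom p π, true, t => ∃ ρ ∈ V π, ρ.Holds t p
  | .atom p π, false, t => ∃ ρ ∈ V π, ρ.Fails t p
  | .and ψ₁ ψ₂, true, t => ψ₁.Sat V true t ∧ ψ₂.Sat V true t
  | .and ψ₁ ψ₂, false, t => ψ₁.Sat V false t ∨ ψ₂.Sat V false t
  | .neg ψ, b, t => ψ.Sat V (!b) t
  | .untl I ψ₁ ψ₂, true, t =>
      ∃ t', t < t' ∧ I.Mem (t' - t) ∧ V.HasTime t' ∧ ψ₂.Sat V true t' ∧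
        ∀ t'', t < t'' → t'' < t' → V.HasTime t'' → ψ₁.Sat V true t''
  | .untl I ψ₁ ψ₂, false, t =>
      ∀ t', t < t' → I.Mem (t' - t) → V.HasTime t' → ψ₂.Sat V false t' ∨
        ∃ t'', t < t'' ∧ t'' < t' ∧ V.HasTime t'' ∧ ψ₁.Sat V false t''
  | .snce I ψ₁ ψ₂, true, t =>
      ∃ t', t' < t ∧ I.Mem (t - t') ∧ V.HasTime t' ∧ ψ₂.Sat V true t' ∧
        ∀ t'', t' < t'' → t'' < t → V.HasTime t'' → ψ₁.Sat V true t''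
  | .snce I ψ₁ ψ₂, false, t =>
      ∀ t', t' < t → I.Mem (t - t') → V.HasTime t' → ψ₂.Sat V false t' ∨
        ∃ t'', t' < t'' ∧ t'' < t ∧ V.HasTime t'' ∧ ψ₁.Sat V false t''

/-- `ρ` has the same timestamps as every trace in the assignment. -/
def Assignment.Synchronises {m : ℕ} (V : Assignment m) (ρ : Trace m) : Prop :=
  ∀ π, ∀ ρ' ∈ V π, ∀ t, ρ'.HasTime t ↔ ρ.HasTime t

/-- Synchronous satisfaction: quantifiers range over the traces of `T` that synchronise with the
current assignment. -/
def Formula.SatSync {m : ℕ} (T : Set (Trace m)) : Formula m → Assignment m → ℝ≥0 → Prop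
  | .ex π φ, V, t => ∃ ρ ∈ T, V.Synchronises ρ ∧ φ.SatSync T (Function.update V π (some ρ)) t
  | .all π φ, V, t => ∀ ρ ∈ T, V.Synchronises ρ → φ.SatSync T (Function.update V π (some ρ)) t
  | .qfree ψ, V, t => ψ.Sat V true t

/-- `T ⊨^sync φ`. -/
def ModelsSync {m : ℕ} (T : Set (Trace m)) (φ : Formula m) : Prop :=
  φ.SatSync T (fun _ => none) 0

/-! ### Instances of the model-checking problem and their codes -/

/-- An instance: a finite set of propositions `Fin nProp`, a model and a specification. -/
structure Instance where
  nProp : ℕ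
  model : TimedAutomaton nProp
  spec : Formula nProp

/-- The question asked by an instance, in the synchronous semantics. -/
def Instance.HoldsSync (x : Instance) : Prop := ModelsSync x.model.language x.spec

/-- Binary code of a finite set. -/
def finsetCode {n : ℕ} (s : Finset (Fin n)) : ℕ := ∑ i ∈ s, 2 ^ (i : ℕ)

def CmpOp.code : CmpOp → ℕ
  | .le => 0
  | .lt => 1
  | .ge => 2
  | .gt => 3

def Guard.code {k : ℕ} : Guard k → ℕ
  | .top => Nat.pair 0 0
  | .and g h => Nat.pair 1 (Nat.pair g.code h.code)
  | .cmp x op c => Nat.pair 2 (Nat.pair x (Nat.pair op.code c))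

def Transition.code {m n k : ℕ} (e : Transition m n k) : ℕ :=
  Nat.pair e.src (Nat.pair (finsetCode e.label)
    (Nat.pair e.guard.code (Nat.pair (finsetCode e.reset) e.dst)))

def TimedAutomaton.code {m : ℕ} (A : TimedAutomaton m) : ℕ :=
  Nat.pair A.nLoc (Nat.pair A.nClk (Nat.pair A.init
    (Nat.pair (Encodable.encode (A.trans.map Transition.code)) (finsetCode A.accepting))))

def TimeInterval.code (I : TimeInterval) : ℕ :=
  Encodable.encode (I.lo, I.loClosed, I.hi)

def QFree.code {m : ℕ} : QFree m → ℕ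
  | .top => Nat.pair 0 0
  | .topOf π => Nat.pair 1 π
  | .atom p π => Nat.pair 2 (Nat.pair p π)
  | .and ψ₁ ψ₂ => Nat.pair 3 (Nat.pair ψ₁.code ψ₂.code)
  | .neg ψ => Nat.pair 4 ψ.code
  | .untl I ψ₁ ψ₂ => Nat.pair 5 (Nat.pair I.code (Nat.pair ψ₁.code ψ₂.code))
  | .snce I ψ₁ ψ₂ => Nat.pair 6 (Nat.pair I.code (Nat.pair ψ₁.code ψ₂.code))

def Formula.code {m : ℕ} : Formula m → ℕ
  | .ex π φ => Nat.pair 0 (Nat.pair π φ.code)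
  | .all π φ => Nat.pair 1 (Nat.pair π φ.code)
  | .qfree ψ => Nat.pair 2 ψ.code

def Instance.code (x : Instance) : ℕ :=
  Nat.pair x.nProp (Nat.pair x.model.code x.spec.code)

/-! The coding is injective. -/

theorem finsetCode_injective {n : ℕ} : Function.Injective (@finsetCode n) := by
  intro s t h
  have key : ∀ s : Finset (Fin n),
      finsetCode s = ∑ i ∈ s.map Fin.valEmbedding, 2 ^ i := by
    intro s; simp [finsetCode]
  rw [key, key] at h
  exact Finset.map_injective _ (Finset.geomSum_injective le_rfl h)

theorem CmpOp.code_injective : Function.Injective CmpOp.code := by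
  intro a b h
  cases a <;> cases b <;> simp_all [CmpOp.code]

theorem Guard.code_injective {k : ℕ} : Function.Injective (@Guard.code k) := by
  intro g
  induction g with
  | top => intro h e; cases h <;> simp_all [Guard.code, Nat.pair_eq_pair]
  | and g₁ g₂ ih₁ ih₂ =>
    intro h e
    cases h <;> simp [Guard.code, Nat.pair_eq_pair] at e ⊢
    exact ⟨ih₁ e.1, ih₂ e.2⟩
  | cmp x op c =>
    intro h e
    cases h <;> simp [Guard.code, Nat.pair_eq_pair] at e ⊢
    exact ⟨Fin.ext e.1, CmpOp.code_injective e.2.1, e.2.2⟩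

theorem Transition.code_injective {m n k : ℕ} : Function.Injective (@Transition.code m n k) := by
  rintro ⟨a, b, c, d, e⟩ ⟨a', b', c', d', e'⟩ h
  simp only [Transition.code, Nat.pair_eq_pair] at h
  obtain ⟨h1, h2, h3, h4, h5⟩ := h
  rw [Fin.ext h1, finsetCode_injective h2, Guard.code_injective h3, finsetCode_injective h4,
    Fin.ext h5]

theorem TimedAutomaton.code_injective {m : ℕ} :
    Function.Injective (@TimedAutomaton.code m) := by
  rintro ⟨n, k, i, l, f⟩ ⟨n', k', i', l', f'⟩ h
  simp only [TimedAutomaton.code, Nat.pair_eq_pair] at h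
  obtain ⟨h1, h2, h3, h4, h5⟩ := h
  subst h1 h2
  rw [Fin.ext h3, Transition.code_injective.list_map (Encodable.encode_injective h4),
    finsetCode_injective h5]

theorem TimeInterval.code_injective : Function.Injective TimeInterval.code := by
  rintro ⟨a, b, c, _⟩ ⟨a', b', c', _⟩ h
  have h' := Encodable.encode_injective h
  simp only [Prod.mk.injEq] at h'
  obtain ⟨rfl, rfl, rfl⟩ := h'
  rfl

theorem QFree.code_injective {m : ℕ} : Function.Injective (@QFree.code m) := by
  intro ψ
  induction ψ with
  | top => intro χ e; cases χ <;> simp_all [QFree.code, Nat.pair_eq_pair]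
  | topOf π => intro χ e; cases χ <;> simp_all [QFree.code, Nat.pair_eq_pair]
  | atom p π =>
    intro χ e
    cases χ <;> simp [QFree.code, Nat.pair_eq_pair] at e ⊢
    exact ⟨Fin.ext e.1, e.2⟩
  | and ψ₁ ψ₂ ih₁ ih₂ =>
    intro χ e
    cases χ <;> simp [QFree.code, Nat.pair_eq_pair] at e ⊢
    exact ⟨ih₁ e.1, ih₂ e.2⟩
  | neg ψ ih =>
    intro χ e
    cases χ <;> simp [QFree.code, Nat.pair_eq_pair] at e ⊢
    exact ih e
  | untl I ψ₁ ψ₂ ih₁ ih₂ =>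
    intro χ e
    cases χ <;> simp [QFree.code, Nat.pair_eq_pair] at e ⊢
    exact ⟨TimeInterval.code_injective e.1, ih₁ e.2.1, ih₂ e.2.2⟩
  | snce I ψ₁ ψ₂ ih₁ ih₂ =>
    intro χ e
    cases χ <;> simp [QFree.code, Nat.pair_eq_pair] at e ⊢
    exact ⟨TimeInterval.code_injective e.1, ih₁ e.2.1, ih₂ e.2.2⟩

theorem Formula.code_injective {m : ℕ} : Function.Injective (@Formula.code m) := by
  intro φ
  induction φ with
  | ex π φ ih =>
    intro χ e
    cases χ <;> simp [Formula.code, Nat.pair_eq_pair] at e ⊢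
    exact ⟨e.1, ih e.2⟩
  | all π φ ih =>
    intro χ e
    cases χ <;> simp [Formula.code, Nat.pair_eq_pair] at e ⊢
    exact ⟨e.1, ih e.2⟩
  | qfree ψ =>
    intro χ e
    cases χ <;> simp [Formula.code, Nat.pair_eq_pair] at e ⊢
    exact QFree.code_injective e

theorem Instance.code_injective : Function.Injective Instance.code := by
  rintro ⟨m, A, φ⟩ ⟨m', A', φ'⟩ h
  simp only [Instance.code, Nat.pair_eq_pair] at h
  obtain ⟨h1, h2, h3⟩ := h
  subst h1
  rw [TimedAutomaton.code_injective h2, Formula.code_injective h3]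

/-- The model-checking problem in the synchronous semantics, restricted to the instances in the
class `C`, is decidable: some computable predicate on natural numbers answers correctly on the
codes of all instances in `C`. -/
def SyncModelCheckingDecidable (C : Instance → Prop) : Prop :=
  ∃ D : ℕ → Prop, ComputablePred D ∧ ∀ x : Instance, C x → (D x.code ↔ x.HoldsSync)

/-- Instances with a one-clock model that has non-singular guards, resets on testing and has
stuttering self-loops, and with an untimed LTL specification. -/
def Instance.IsRestricted (x : Instance) : Prop :=
  x.model.OneClock ∧ x.model.NonSingular ∧ x.model.ResetOnTesting ∧ x.model.HasStutterLoops ∧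
    x.spec.body.IsLTL

end HyperMTL

/-!
The halting problem of a universal multi-stack machine is reduced to model checking of `∃∀∀`
sentences; the sentences with pattern `∀∃∃` are their negations (`modelsSync_forallExists_neg`).

The witness for `∃` is a space-time diagram of the machine, written row by row as a timed word, each
row being one configuration. The rows of a computation of unknown length have an unknown width `s`,
so a formula has to compare positions `i` and `i + s` without a bound on `s`. This is where the
clock comes in. The automaton `marker` accepts, among others, all words over the alphabet of the
diagram and words in which exactly two positions are marked, with the mark `near` or `far` on the
second one telling that their distance in time is at most `1`, respectively more than `1`. In the
synchronous semantics the two universal quantifiers range over the markings of the positions of the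
diagram. With one trace of each kind an untimed formula can say:

* if `i`, `j` are at distance at most `1`, then so are `i + 1`, `j + 1`, and conversely, so that the
  number `s` of letters in the time unit after a letter is the same everywhere;
* the second row starts `s` letters after the first one;
* if `i`, `j` are at distance at most `1`, but `i`, `j + 1` are not, which means `j = i + s`, then
  the letters at `i`, `i + 1`, `j`, `j + 1` satisfy a given local relation.

Conversely, a diagram of width `s` is a word with `s` events per unit of time. Thus the instances
express the solvability of a tiling problem on a helix (`TileSystem.HasTiling`), which is the
content of `modelsSync_iff_hasTiling`. Only atoms, untimed operators and non-singular guards are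
used, as "distance exactly `1`" is never tested.

In the tiling problem, the columns of a row carry the control state and the stacks side by side,
with the tops in the first column, so that pushing and popping shift a row by one position and are
local (`hasTiling_columns_iff`). The machine runs the `TM2` program that Mathlib associates with a
partial recursive function, statement by statement. The automaton and the formula are fixed, except
for the part of the formula that prescribes the first row. Inputs are taken to be powers of two,
whose binary notation is `0 ⋯ 0 1`, least significant digit first, so that the code of this part is
obtained by iterating a primitive recursive function (`primrec_prefixF_code`).
-/

namespace HyperMTL

open Turing StateTransition

/-! ### Multi-stack machines -/

/-- An operation on a stack. -/
inductive StackOp (Γ : Type) where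
  | keep
  | pop
  | push (γ : Γ)

/-- The effect of an operation on a stack, whose top is the head of the list. -/
def StackOp.apply {Γ : Type} : StackOp Γ → List Γ → List Γ
  | .keep, l => l
  | .pop, l => l.tail
  | .push γ, l => γ :: l

/-- A deterministic machine with control states `Q` and one stack for each element of `K`. The
next control state depends on the tops of all stacks, but the operations performed on the stacks
depend on the control state only. A machine does not stop in its halting states. -/
structure StackMachine (Q K Γ : Type) where
  next : Q → (K → Option Γ) → Q
  op : Q → K → StackOp Γ
  halted : Q → Prop

namespace StackMachine

variable {Q K Γ : Type} (M : StackMachine Q K Γ)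

/-- One step on a configuration, that is, a control state and the contents of the stacks. -/
def step (c : Q × (K → List Γ)) : Q × (K → List Γ) :=
  (M.next c.1 fun k => (c.2 k).head?, fun k => (M.op c.1 k).apply (c.2 k))

/-- `M` eventually visits a halting state. -/
def Halts (c : Q × (K → List Γ)) : Prop :=
  ∃ r : ℕ, M.halted (M.step^[r] c).1

/-- The restriction of a machine to a set of control states that is closed under `next`. -/
def restrict (P : Q → Prop) (hP : ∀ q t, P q → P (M.next q t)) :
    StackMachine {q // P q} K Γ where
  next q t := ⟨M.next q.1 t, hP _ _ q.2⟩
  op q := M.op q.1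
  halted q := M.halted q.1

theorem restrict_halts (P : Q → Prop) (hP : ∀ q t, P q → P (M.next q t)) (q : {q // P q})
    (S : K → List Γ) : (M.restrict P hP).Halts (q, S) ↔ M.Halts (q.1, S) := by
  have key : ∀ r (c : {q // P q} × (K → List Γ)),
      M.step^[r] (c.1.1, c.2) =
        (((M.restrict P hP).step^[r] c).1.1, ((M.restrict P hP).step^[r] c).2) := by
    intro r
    induction r with
    | zero => intro c; rfl
    | succ r ih =>
      intro c
      rw [Function.iterate_succ_apply, Function.iterate_succ_apply, ← ih]
      rfl
  refine exists_congr fun r => ?_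
  rw [key r (q, S)]
  rfl

end StackMachine

theorem some_mem_stmts {K Γ Λ σ : Type} (P : Λ → TM2.Stmt (fun _ : K => Γ) Λ σ) {S : Finset Λ}
    {l : Λ} (h : l ∈ S) : some (P l) ∈ TM2.stmts P S := by
  simp only [TM2.stmts, Finset.some_mem_insertNone, Finset.mem_biUnion]
  exact ⟨l, h, TM2.stmts₁_self⟩

section OfTM2

variable {K Γ Λ σ : Type} [DecidableEq K]

open TM2

/-- The statement-by-statement execution of a `TM2` program as a stack machine: the control state
consists of the statement to be executed (`none` after halting) and the local variables. -/
def ofTM2 (P : Λ → Stmt (fun _ : K => Γ) Λ σ) :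
    StackMachine (Option (Stmt (fun _ : K => Γ) Λ σ) × σ) K Γ where
  next
    | (none, v), _ => (none, v)
    | (some (.push _ _ q), v), _ => (some q, v)
    | (some (.peek k f q), v), t => (some q, f v (t k))
    | (some (.pop k f q), v), t => (some q, f v (t k))
    | (some (.load a q), v), _ => (some q, a v)
    | (some (.branch f q₁ q₂), v), _ => (some (cond (f v) q₁ q₂), v)
    | (some (.goto f), v), _ => (some (P (f v)), v)
    | (some .halt, v), _ => (none, v)
  op
    | (some (.push k f _), v) => Function.update (fun _ => .keep) k (.push (f v))
    | (some (.pop k _ _), _) => Function.update (fun _ => .keep) k .pop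
    | _ => fun _ => .keep
  halted q := q.1 = none

variable (P : Λ → Stmt (fun _ : K => Γ) Λ σ)

theorem apply_update_op (S : K → List Γ) (k : K) (o : StackOp Γ) :
    (fun j => ((Function.update (fun _ => StackOp.keep) k o : K → StackOp Γ) j).apply (S j)) =
      Function.update S k (o.apply (S k)) := by
  funext j
  rcases eq_or_ne j k with rfl | h
  · simp
  · simp [h, StackOp.apply]

open Classical in
/-- `(ofTM2 P).step`, stopped in halting configurations. -/
noncomputable def ofTM2Step (c : (Option (Stmt (fun _ : K => Γ) Λ σ) × σ) × (K → List Γ)) :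
    Option ((Option (Stmt (fun _ : K => Γ) Λ σ) × σ) × (K → List Γ)) :=
  if c.1.1 = none then none else some ((ofTM2 P).step c)

/-- One `TM2` step is simulated by at least one step, as even `halt` and `goto` take a step. -/
theorem reaches₁_stepAux (q : Stmt (fun _ : K => Γ) Λ σ) (v : σ) (S : K → List Γ) :
    Reaches₁ (ofTM2Step P) ((some q, v), S)
      (((stepAux q v S).l.map P, (stepAux q v S).var), (stepAux q v S).stk) := by
  have one : ∀ c, c.1.1 ≠ none → ofTM2Step P c = some ((ofTM2 P).step c) := by
    intro c h; simp [ofTM2Step, h]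
  induction q generalizing v S with
  | push k f q ih =>
    refine Relation.TransGen.head (b := ((some q, v), Function.update S k (f v :: S k))) ?_ (ih _ _)
    rw [one _ (by simp)]
    simp only [StackMachine.step, ofTM2, Option.mem_def, apply_update_op]
    rfl
  | peek k f q ih =>
    refine Relation.TransGen.head (b := ((some q, f v (S k).head?), S)) ?_ (ih _ _)
    rw [one _ (by simp)]; rfl
  | pop k f q ih =>
    refine Relation.TransGen.head
      (b := ((some q, f v (S k).head?), Function.update S k (S k).tail)) ?_ (ih _ _)
    rw [one _ (by simp)]
    simp only [StackMachine.step, ofTM2, Option.mem_def, apply_update_op]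
    rfl
  | load a q ih =>
    refine Relation.TransGen.head (b := ((some q, a v), S)) ?_ (ih _ _)
    rw [one _ (by simp)]; rfl
  | branch f q₁ q₂ ih₁ ih₂ =>
    refine Relation.TransGen.head (b := ((some (cond (f v) q₁ q₂), v), S)) ?_ ?_
    · rw [one _ (by simp)]; rfl
    · cases h : f v
      · rw [TM2.stepAux, h]; exact ih₂ v S
      · rw [TM2.stepAux, h]; exact ih₁ v S
  | goto f => exact Relation.TransGen.single (by rw [one _ (by simp)]; rfl)
  | halt => exact Relation.TransGen.single (by rw [one _ (by simp)]; rfl)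

theorem ofTM2_respects : Respects (TM2.step P) (ofTM2Step P)
    (fun c d => d = ((c.l.map P, c.var), c.stk)) := by
  rintro ⟨l, v, S⟩ _ rfl
  cases l with
  | none => simp [ofTM2Step]
  | some l => exact ⟨_, rfl, reaches₁_stepAux P (P l) v S⟩

theorem ofTM2_eval_dom (c : (Option (Stmt (fun _ : K => Γ) Λ σ) × σ) × (K → List Γ)) :
    (eval (ofTM2Step P) c).Dom ↔ (ofTM2 P).Halts c := by
  constructor
  · intro h
    obtain ⟨hr, hb⟩ := mem_eval.1 (Part.get_mem h)
    have halted : ((eval (ofTM2Step P) c).get h).1.1 = none := by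
      by_contra hne; simp [ofTM2Step, hne] at hb
    have key : ∀ b, Reaches (ofTM2Step P) c b → ∃ r, (ofTM2 P).step^[r] c = b := by
      intro b hb
      induction hb with
      | refl => exact ⟨0, rfl⟩
      | tail _ hs ih =>
        obtain ⟨r, rfl⟩ := ih
        refine ⟨r + 1, ?_⟩
        rw [Function.iterate_succ_apply']
        simp only [ofTM2Step, Option.mem_def] at hs
        split_ifs at hs
        exact Option.some.inj hs
    obtain ⟨r, hr⟩ := key _ hr
    exact ⟨r, by rw [hr]; exact halted⟩
  · rintro ⟨r, hr⟩
    induction r generalizing c with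
    | zero =>
      exact Part.dom_iff_mem.2 ⟨c, mem_eval.2 ⟨.refl, by
        have : c.1.1 = none := hr
        simp [ofTM2Step, this]⟩⟩
    | succ r ih =>
      by_cases h : c.1.1 = none
      · exact Part.dom_iff_mem.2 ⟨c, mem_eval.2 ⟨.refl, by simp [ofTM2Step, h]⟩⟩
      · rw [reaches_eval (b := (ofTM2 P).step c) (.single (by simp [ofTM2Step, h]))]
        exact ih _ hr

theorem ofTM2_halts_iff (c : Cfg (fun _ : K => Γ) Λ σ) :
    (ofTM2 P).Halts ((c.l.map P, c.var), c.stk) ↔ (eval (TM2.step P) c).Dom := by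
  rw [← ofTM2_eval_dom]
  exact tr_eval_dom (ofTM2_respects P) rfl

/-- A set of labels supporting a program yields a set of control states, closed under `next`. -/
theorem ofTM2_next_mem [Inhabited Λ] {S : Finset Λ} (hS : TM2.Supports P S)
    (q : Option (Stmt (fun _ : K => Γ) Λ σ) × σ) (t : K → Option Γ) (h : q.1 ∈ stmts P S) :
    ((ofTM2 P).next q t).1 ∈ stmts P S := by
  obtain ⟨q, v⟩ := q
  have sub : ∀ {q₁ q₂ : Stmt (fun _ : K => Γ) Λ σ}, q₁ ∈ stmts₁ q₂ → some q₂ ∈ stmts P S →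
      some q₁ ∈ stmts P S := stmts_trans
  have hnone : (none : Option (Stmt (fun _ : K => Γ) Λ σ)) ∈ stmts P S := by simp [stmts]
  match q with
  | none => exact hnone
  | some (.push _ _ q) => exact sub (by simp [stmts₁, stmts₁_self]) h
  | some (.peek _ _ q) => exact sub (by simp [stmts₁, stmts₁_self]) h
  | some (.pop _ _ q) => exact sub (by simp [stmts₁, stmts₁_self]) h
  | some (.load _ q) => exact sub (by simp [stmts₁, stmts₁_self]) h
  | some (.branch f q₁ q₂) =>
    refine sub ?_ h
    cases hf : f v <;> simp [stmts₁, stmts₁_self]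
  | some (.goto f) =>
    exact some_mem_stmts P (stmts_supportsStmt hS h v)
  | some .halt => exact hnone

end OfTM2

/-! ### An undecidable halting problem -/

theorem trNat_two_pow (k : ℕ) :
    PartrecToTM2.trNat (2 ^ k) =
      List.replicate k PartrecToTM2.Γ'.bit0 ++ [PartrecToTM2.Γ'.bit1] := by
  have h1 : ∀ k : ℕ, ((2 ^ k : ℕ) : Num) = Num.pos (PosNum.bit0^[k] 1) := by
    intro k
    have : ∀ k : ℕ, ((PosNum.bit0^[k] 1 : PosNum) : ℕ) = 2 ^ k := by
      intro k
      induction k with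
      | zero => simp
      | succ k ih => rw [Function.iterate_succ_apply', PosNum.cast_bit0, ih]; ring
    apply Num.to_nat_inj.1
    rw [Num.to_of_nat, ← this]
    rfl
  rw [PartrecToTM2.trNat, h1, PartrecToTM2.trNum]
  induction k with
  | zero => rfl
  | succ k ih =>
    rw [Function.iterate_succ_apply', PartrecToTM2.trPosNum, ih]
    rfl

/-- A primitive recursive binary logarithm, shifted by one. -/
theorem exists_primrec_log : ∃ h : ℕ → ℕ, Primrec h ∧ ∀ k, h (2 ^ (k + 1)) = k := by
  have pow : Primrec fun m : ℕ => 2 ^ m := by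
    refine (Primrec.nat_iterate Primrec.id (Primrec.const 1)
      ((Primrec.nat_mul.comp (Primrec.const 2) Primrec.snd).to₂ (α := ℕ))).of_eq fun n => ?_
    induction n with
    | zero => rfl
    | succ n ih => simp only [id] at ih ⊢; rw [Function.iterate_succ_apply', ih]; ring
  have rel : PrimrecRel fun x m : ℕ => 2 ^ m ≤ x :=
    Primrec.nat_le.comp₂ (pow.comp Primrec.snd).to₂ Primrec.fst.to₂
  refine ⟨fun x => x.findGreatest (fun m => 2 ^ m ≤ x) - 1,
    Primrec.nat_sub.comp (Primrec.nat_findGreatest Primrec.id rel) (Primrec.const 1), fun k => ?_⟩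
  have : (2 ^ (k + 1)).findGreatest (fun m => 2 ^ m ≤ 2 ^ (k + 1)) = k + 1 := by
    rw [Nat.findGreatest_eq_iff]
    refine ⟨Nat.lt_two_pow_self.le, fun _ => le_rfl, fun n hn _ h => ?_⟩
    have := (Nat.pow_le_pow_iff_right (by norm_num : 1 < 2)).1 h
    omega
  simp [this]

/-- The stacks of the machines of `Turing.PartrecToTM2` on the input `2 ^ (k + 1)`. -/
def inputStacks (k : ℕ) : PartrecToTM2.K' → List PartrecToTM2.Γ' :=
  PartrecToTM2.K'.elim (List.replicate (k + 1) .bit0 ++ [.bit1, .cons]) [] [] []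

/-- A universal machine, of which the `k`-th input is a power of two: in binary these inputs have
a particularly simple shape. -/
theorem exists_undecidable_stackMachine :
    ∃ (Q : Type) (_ : Finite Q) (M : StackMachine Q PartrecToTM2.K' PartrecToTM2.Γ') (q : Q),
      ¬ ComputablePred fun k : ℕ => M.Halts (q, inputStacks k) := by
  obtain ⟨h, hh, hk⟩ := exists_primrec_log
  -- The universal function, reading the code off the exponent of its argument.
  let f : ℕ →. ℕ := fun x => Nat.Partrec.Code.eval (Denumerable.ofNat Nat.Partrec.Code (h x)) 0
  have hf : Partrec f :=
    Nat.Partrec.Code.eval_part.comp ((Computable.ofNat _).comp hh.to_comp) (Computable.const 0)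
  obtain ⟨c, hc⟩ := ToPartrec.Code.exists_code (Nat.Partrec'.part_iff₁.2 hf)
  let P := PartrecToTM2.tr
  let l := PartrecToTM2.trNormal c PartrecToTM2.Cont'.halt
  let _ : Inhabited PartrecToTM2.Λ' := ⟨l⟩
  let S := PartrecToTM2.codeSupp c PartrecToTM2.Cont'.halt
  have hS : TM2.Supports P S := PartrecToTM2.tr_supports c _
  have hl : some (P l) ∈ TM2.stmts P S := some_mem_stmts P hS.1
  let M := (ofTM2 P).restrict (fun q => q.1 ∈ TM2.stmts P S)
    (fun q t hq => ofTM2_next_mem P hS q t hq)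
  refine ⟨_, ?_, M, ⟨(some (P l), none), hl⟩, fun hdec => ?_⟩
  · refine Finite.of_injective
      (β := {s // s ∈ TM2.stmts P S} × Option PartrecToTM2.Γ') (fun q => (⟨q.1.1, q.2⟩, q.1.2)) ?_
    rintro ⟨⟨a, b⟩, _⟩ ⟨⟨a', b'⟩, _⟩ e
    simp only [Prod.mk.injEq, Subtype.mk.injEq] at e
    simp [e.1, e.2]
  · apply ComputablePred.halting_problem 0
    have key : ∀ k, M.Halts (⟨(some (P l), none), hl⟩, inputStacks k) ↔
        (Nat.Partrec.Code.eval (Denumerable.ofNat Nat.Partrec.Code k) 0).Dom := by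
      intro k
      rw [StackMachine.restrict_halts]
      have e : PartrecToTM2.init c [2 ^ (k + 1)] = ⟨some l, none, inputStacks k⟩ := by
        simp [PartrecToTM2.init, inputStacks, trNat_two_pow, l]
        rfl
      have := ofTM2_halts_iff P (PartrecToTM2.init c [2 ^ (k + 1)])
      rw [PartrecToTM2.tr_eval, e] at this
      refine this.trans ?_
      have h2 := hc ⟨[2 ^ (k + 1)], rfl⟩
      simp only at h2
      rw [h2]
      simp [f, List.Vector.head, hk]
    have := hdec.of_eq key
    obtain ⟨D, hD⟩ := ComputablePred.computable_iff.1 this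
    refine ComputablePred.computable_iff.2 ⟨fun c => D (Encodable.encode c),
      hD.1.comp Computable.encode, ?_⟩
    funext c
    have := congrFun hD.2 (Encodable.encode c)
    simpa using this

/-! ### Helical tilings -/

/-- A tiling problem for words cut into rows of equal width, the end of a row being adjacent to
the start of the next one. The relation `rel x y z t` constrains a letter `x`, its successor `y`,
and the letters `z` and `t` one row below them. -/
structure TileSystem (C : Type) where
  rel : C → C → C → C → Prop
  start : C → Prop
  final : C → Prop
  blank : C

/-- There are a row width `s` and a word `w` of length `n` such that the first row is `u`, filled
up with blanks, the second row begins with a starting letter, the local relation holds throughout,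
and some letter other than the last one is final. The last letter is excluded because no instance
of `rel` constrains it from the left. -/
def TileSystem.HasTiling {C : Type} (D : TileSystem C) (u : List C) : Prop :=
  ∃ (w : ℕ → C) (s n : ℕ), u.length ≤ s ∧ s + 1 < n ∧ (∀ i (h : i < u.length), w i = u[i]) ∧
    (∀ i, u.length ≤ i → i < s → w i = D.blank) ∧ D.start (w s) ∧
    (∀ i, i + s + 1 < n → D.rel (w i) (w (i + 1)) (w (i + s)) (w (i + s + 1))) ∧
    ∃ i, i + 1 < n ∧ D.final (w i)

/-- A column of a configuration: the control state, a mark on the first column, and one symbol of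
each stack (`none` below its bottom). -/
@[ext]
structure Cell (Q K Γ : Type) where
  ctl : Q
  start : Bool
  stk : K → Option Γ

instance {Q K Γ : Type} [Finite Q] [Finite K] [Finite Γ] : Finite (Cell Q K Γ) :=
  Finite.of_injective (β := Q × Bool × (K → Option Γ)) (fun c => (c.ctl, c.start, c.stk)) <| by
    intro c d h
    simp only [Prod.mk.injEq] at h
    exact Cell.ext h.1 h.2.1 h.2.2

section Columns

variable {Q K Γ : Type}

/-- The `j`-th column of a configuration. The tops of the stacks are in column `0`. -/
def column (c : Q × (K → List Γ)) (j : ℕ) : Cell Q K Γ :=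
  ⟨c.1, decide (j = 0), fun k => (c.2 k)[j]?⟩

/-- The first `len` columns of a configuration. -/
def columns (c : Q × (K → List Γ)) (len : ℕ) : List (Cell Q K Γ) :=
  (List.range len).map (column c)

/-- The local relation describing the effect of an operation on one stack: `x` and `z` are the
entries of a column before and after it, `y` and `t` those of the next column. If `edge` holds then
`x` and `z` are in the last column, and nothing may be pushed out of the row. -/
def StackOp.Local (o : StackOp Γ) (first edge : Bool) (x y z t : Option Γ) : Prop :=
  match o with
  | .keep => z = x
  | .pop => z = if edge then none else y
  | .push γ => (first → z = some γ) ∧ (if edge then x = none else t = x)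

/-- The tiles describing the runs of a stack machine with initial control state `q`. -/
def StackMachine.tiles (M : StackMachine Q K Γ) (q : Q) : TileSystem (Cell Q K Γ) where
  rel x y z t := z.start = x.start ∧ (x.start → z.ctl = M.next x.ctl x.stk) ∧
    (¬ y.start → t.ctl = z.ctl) ∧
    ∀ k, (M.op x.ctl k).Local x.start y.start (x.stk k) (y.stk k) (z.stk k) (t.stk k)
  start x := x.start
  final x := M.halted x.ctl
  blank := ⟨q, false, fun _ => none⟩

variable (M : StackMachine Q K Γ)

theorem StackOp.length_apply_le (o : StackOp Γ) (l : List Γ) :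
    (o.apply l).length ≤ l.length + 1 := by
  cases o <;> simp [StackOp.apply]; omega

theorem StackMachine.length_iterate_le {c : Q × (K → List Γ)} {len : ℕ}
    (h : ∀ k, (c.2 k).length ≤ len) (r : ℕ) (k : K) :
    ((M.step^[r] c).2 k).length ≤ len + r := by
  induction r with
  | zero => exact h k
  | succ r ih =>
    rw [Function.iterate_succ_apply']
    exact (StackOp.length_apply_le _ _).trans (by omega)

theorem column_eq_blank {c : Q × (K → List Γ)} {len j : ℕ} (h0 : 0 < len)
    (h : ∀ k, (c.2 k).length ≤ len) (hj : len ≤ j) :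
    column c j = (M.tiles c.1).blank := by
  ext
  · rfl
  · simp [column, StackMachine.tiles]; omega
  · simp only [column, StackMachine.tiles]
    rw [List.getElem?_eq_none ((h _).trans hj)]

/-- Consecutive configurations that fit into the width satisfy the local relation. -/
theorem rel_column (c : Q × (K → List Γ)) (q : Q) {s j : ℕ} (hj : j < s)
    (h : ∀ k, (c.2 k).length < s) (e : Q × (K → List Γ)) (y t : Cell Q K Γ)
    (hy : y = if j + 1 = s then column (M.step c) 0 else column c (j + 1))
    (ht : t = if j + 1 = s then column e 0 else column (M.step c) (j + 1)) :
    (M.tiles q).rel (column c j) y (column (M.step c) j) t := by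
  have hys : y.start = true ↔ j + 1 = s := by
    subst hy
    split_ifs with h1 <;> simp [column, h1]
  refine ⟨rfl, ?_, ?_, fun k => ?_⟩
  · intro h0
    have : j = 0 := by simpa [column] using h0
    subst this
    simp only [column, StackMachine.step, List.head?_eq_getElem?]
  · intro h1
    rw [hys] at h1
    simp [ht, h1, column]
  · have hk := h k
    have hop : (M.step c).2 k = (M.op c.1 k).apply (c.2 k) := rfl
    simp only [column, hop]
    cases ho : M.op c.1 k with
    | keep => rfl
    | pop =>
      simp only [StackOp.Local, StackOp.apply, hys, List.getElem?_tail]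
      split_ifs with h1
      · exact List.getElem?_eq_none (by omega)
      · simp [hy, h1, column]
    | push γ =>
      simp only [StackOp.Local, StackOp.apply, hys]
      refine ⟨fun h0 => ?_, ?_⟩
      · have : j = 0 := by simpa using h0
        simp [this]
      · split_ifs with h1
        · exact List.getElem?_eq_none (by omega)
        · simp [ht, h1, column, hop, ho, StackOp.apply]

theorem hasTiling_of_halts {c : Q × (K → List Γ)} {len : ℕ} (h0 : 0 < len)
    (hlen : ∀ k, (c.2 k).length ≤ len) (h : M.Halts c) :
    (M.tiles c.1).HasTiling (columns c len) := by
  obtain ⟨r, hr⟩ := h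
  -- Stacks grow by one symbol per step at most, so this width is never exceeded.
  set s := len + r + 2 with hs
  have hs0 : 0 < s := by omega
  refine ⟨fun p => column (M.step^[p / s] c) (p % s), s, (r + 2) * s, ?_, ?_, ?_, ?_, ?_, ?_,
    r * s, ?_, ?_⟩
  · simp [columns]; omega
  · nlinarith
  · intro i hi
    have : i < s := by simp [columns] at hi; omega
    simp [columns, Nat.div_eq_of_lt this, Nat.mod_eq_of_lt this]
  · intro i hi his
    simp only [Nat.div_eq_of_lt his, Nat.mod_eq_of_lt his, Function.iterate_zero, id]
    exact column_eq_blank M h0 hlen (by simpa [columns] using hi)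
  · simp [StackMachine.tiles, column]
  · intro i hi
    have hdiv : (i + s) / s = i / s + 1 := Nat.add_div_right _ hs0
    have hmod : (i + s) % s = i % s := Nat.add_mod_right _ _
    have hr' : i / s < r + 2 := by
      rw [Nat.div_lt_iff_lt_mul hs0]; omega
    have hle : i / s ≤ r := by
      have : i / s < r + 1 := by
        rw [Nat.div_lt_iff_lt_mul hs0]
        have : (r + 2) * s = (r + 1) * s + s := by ring
        omega
      omega
    have step : ∀ p, p % s + 1 = s → (p + 1) / s = p / s + 1 ∧ (p + 1) % s = 0 := by
      intro p hp
      have h1 := Nat.div_add_mod p s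
      have : p + 1 = s * (p / s + 1) := by rw [mul_add]; omega
      exact ⟨by rw [this, Nat.mul_div_cancel_left _ hs0], by rw [this, Nat.mul_mod_right]⟩
    have stay : ∀ p, p % s + 1 ≠ s → (p + 1) / s = p / s ∧ (p + 1) % s = p % s + 1 := by
      intro p hp
      have h1 := Nat.div_add_mod p s
      have h2 := Nat.mod_lt p hs0
      have : p + 1 = p % s + 1 + s * (p / s) := by omega
      rw [this, Nat.add_mul_div_left _ _ hs0, Nat.add_mul_mod_self_left,
        Nat.div_eq_of_lt (by omega), Nat.mod_eq_of_lt (by omega), zero_add]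
      exact ⟨rfl, rfl⟩
    have := rel_column M (M.step^[i / s] c) c.1 (Nat.mod_lt i hs0)
      (fun k => (M.length_iterate_le hlen _ k).trans_lt (by omega))
      (M.step^[i / s + 2] c) (column (M.step^[(i + 1) / s] c) ((i + 1) % s))
      (column (M.step^[(i + s + 1) / s] c) ((i + s + 1) % s)) ?_ ?_
    · simpa only [hdiv, hmod, Function.iterate_succ_apply'] using this
    · split_ifs with h1
      · rw [(step i h1).1, (step i h1).2, Function.iterate_succ_apply']
      · rw [(stay i h1).1, (stay i h1).2]
    · split_ifs with h1
      · rw [← hmod] at h1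
        rw [(step _ h1).1, (step _ h1).2, hdiv]
      · rw [← hmod] at h1
        rw [(stay _ h1).1, (stay _ h1).2, hdiv, Function.iterate_succ_apply', hmod]
  · nlinarith
  · simpa [StackMachine.tiles, column, Nat.mul_div_cancel _ hs0] using hr

/-- By induction along the word, the letters of the row `r` are the columns of the `r`-th
configuration, whose stacks fit into the width; the last letter of the word is not determined. -/
theorem halts_of_hasTiling {c : Q × (K → List Γ)} {len : ℕ} (h2 : 2 ≤ len)
    (hlen : ∀ k, (c.2 k).length ≤ len) (h : (M.tiles c.1).HasTiling (columns c len)) :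
    M.Halts c := by
  obtain ⟨w, s, n, hs, -, hinit, hblank, -, hrel, i, hi, hfin⟩ := h
  have hcl : (columns c len).length = len := by simp [columns]
  replace hinit : ∀ i, i < len → w i = column c i := by
    intro i hi
    rw [hinit i (hi.trans_eq hcl.symm)]
    simp [columns]
  rw [hcl] at hs hblank
  have hs0 : 0 < s := by omega
  have key : ∀ r j, j < s → s * r + j + 1 < n → w (s * r + j) = column (M.step^[r] c) j ∧
      (j + 1 = s → ∀ k, ((M.step^[r] c).2 k).length ≤ s) := by
    intro r
    induction r with
    | zero =>
      intro j hj hn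
      refine ⟨?_, fun _ k => (hlen k).trans hs⟩
      rcases lt_or_ge j len with h | h
      · simpa using hinit j h
      · simpa [column_eq_blank M (by omega : 0 < len) hlen h] using hblank j h hj
    | succ r ihr =>
      intro j
      induction j with
      | zero =>
        intro hj hn
        have e : s * (r + 1) + 0 = s * r + 0 + s := by ring
        obtain ⟨hx, -⟩ := ihr 0 hj (by omega)
        obtain ⟨hy, -⟩ := ihr 1 (by omega) (by omega)
        have R := hrel (s * r + 0) (by omega)
        rw [← e, hx, show s * r + 0 + 1 = s * r + 1 by ring, hy] at R
        obtain ⟨R1, R2, -, R4⟩ := R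
        refine ⟨?_, by omega⟩
        rw [Function.iterate_succ_apply']
        ext k γ
        · rw [R2 (by simp [column])]
          simp [column, StackMachine.step, List.head?_eq_getElem?]
        · rw [R1]; rfl
        · have := R4 k
          simp only [column, StackMachine.step] at this ⊢
          cases hop : M.op (M.step^[r] c).1 k <;> rw [hop] at this <;>
            simp_all [StackOp.Local, StackOp.apply]
      | succ j ihj =>
        intro hj hn
        obtain ⟨hz, -⟩ := ihj (by omega) (by omega)
        have hsr : s * (r + 1) = s * r + s := mul_add_one s r
        obtain ⟨hx, -⟩ := ihr j (by omega) (by omega)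
        obtain ⟨hx', hwidth⟩ := ihr (j + 1) hj (by omega)
        -- Pushed symbols and the control state come from the window one column to the left.
        have L := hrel (s * r + j) (by omega)
        rw [show s * r + j + s = s * (r + 1) + j by ring, hx, hz,
          show s * r + j + 1 = s * r + (j + 1) by ring, hx'] at L
        obtain ⟨-, -, L3, L4⟩ := L
        have R := hrel (s * r + (j + 1)) (by omega)
        have hy : (w (s * r + (j + 1) + 1)).start = decide (j + 2 = s) ∧
            (j + 2 ≠ s → w (s * r + (j + 1) + 1) = column (M.step^[r] c) (j + 2)) := by
          rcases eq_or_ne (j + 2) s with h | h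
          · have e : s * r + (j + 1) + 1 = s * r + 0 + s := by omega
            have hstart := (hrel (s * r + 0) (by omega)).1
            obtain ⟨h0, -⟩ := ihr 0 (by omega) (by omega)
            rw [e, hstart, h0]
            exact ⟨by simp [column, h], fun h' => absurd h h'⟩
          · obtain ⟨h', -⟩ := ihr (j + 2) (by omega) (by omega)
            rw [show s * r + (j + 1) + 1 = s * r + (j + 2) by ring, h']
            exact ⟨by simp [column, h], fun _ => rfl⟩
        rw [show s * r + (j + 1) + s = s * (r + 1) + (j + 1) by ring, hx'] at R
        obtain ⟨R1, -, -, R4⟩ := R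
        have hstep : M.step^[r + 1] c = M.step (M.step^[r] c) := Function.iterate_succ_apply' ..
        rw [hstep] at hz ⊢
        constructor
        · ext k γ
          · rw [show s * (r + 1) + (j + 1) = s * (r + 1) + j + 1 by ring,
              L3 (by simp [column])]
            simp [column, hstep]
          · rw [R1]; rfl
          · have l := L4 k
            have rr := R4 k
            rw [hy.1] at rr
            simp only [column, StackMachine.step, hstep] at l rr ⊢
            cases hop : M.op (M.step^[r] c).1 k <;> rw [hop] at l rr <;>
              simp only [StackOp.Local, StackOp.apply, List.getElem?_tail] at l rr ⊢
            · rw [rr]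
            · rw [rr]
              split_ifs with h
              · have h' : j + 2 = s := by simpa using h
                rw [List.getElem?_eq_none ((hwidth h' k).trans (by omega))]
                simp
              · rw [hy.2 (by simpa using h)]
                rfl
            · have l2 := l.2
              rw [if_neg (by simp)] at l2
              rw [show s * (r + 1) + (j + 1) = s * (r + 1) + j + 1 by ring, l2]
              simp
        · intro h k
          have rr := R4 k
          have hw := hwidth h k
          rw [hy.1] at rr
          simp only [column, StackMachine.step] at rr ⊢
          cases hop : M.op (M.step^[r] c).1 k <;> rw [hop] at rr <;>
            simp only [StackOp.Local, StackOp.apply] at rr ⊢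
          · exact hw
          · simp; omega
          · have r2 := rr.2
            rw [if_pos (by simpa using h)] at r2
            rw [List.getElem?_eq_none_iff] at r2
            simp; omega
  obtain ⟨hw, -⟩ := key (i / s) (i % s) (Nat.mod_lt _ hs0) (by rw [Nat.div_add_mod]; exact hi)
  rw [Nat.div_add_mod] at hw
  refine ⟨i / s, ?_⟩
  rw [hw] at hfin
  exact hfin

theorem hasTiling_columns_iff {c : Q × (K → List Γ)} {len : ℕ} (h2 : 2 ≤ len)
    (hlen : ∀ k, (c.2 k).length ≤ len) :
    (M.tiles c.1).HasTiling (columns c len) ↔ M.Halts c :=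
  ⟨halts_of_hasTiling M h2 hlen, hasTiling_of_halts M (by omega) hlen⟩

end Columns

/-! ### Untimed formulae on synchronised traces -/

theorem Trace.label_unique {m : ℕ} (ρ : Trace m) {σ σ' : Letter m} {t : ℝ≥0}
    (h : (σ, t) ∈ ρ.events) (h' : (σ', t) ∈ ρ.events) : σ = σ' := by
  have hinc := List.pairwise_iff_getElem.1 ρ.increasing
  obtain ⟨i, hi, hi'⟩ := List.mem_iff_getElem.1 h
  obtain ⟨j, hj, hj'⟩ := List.mem_iff_getElem.1 h'
  rcases lt_trichotomy i j with hij | rfl | hij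
  · have := hinc i j hi hj hij
    simp [hi', hj'] at this
  · exact congrArg Prod.fst (hi'.symm.trans hj')
  · have := hinc j i hj hi hij
    simp [hi', hj'] at this

namespace QFree

variable {m : ℕ}

/-- An unsatisfiable formula. -/
def bot : QFree m := .and .top (.neg .top)

/-- Disjunction, whose two polarities are those of the disjuncts. -/
def or (φ χ : QFree m) : QFree m := .neg (.and (.neg φ) (.neg χ))

/-- The disjunction of a list of formulae. -/
def disj (L : List (QFree m)) : QFree m := L.foldr QFree.or bot

/-- `φ` holds at the next event. -/
def next (φ : QFree m) : QFree m := .untl TimeInterval.full bot φ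

/-- `φ` holds at some later event. -/
def eventually (φ : QFree m) : QFree m := .untl TimeInterval.full .top φ

/-- Every atom is in the scope of a temporal operator. -/
def Guarded : QFree m → Prop
  | .atom _ _ => False
  | .and φ χ => φ.Guarded ∧ χ.Guarded
  | .neg φ => φ.Guarded
  | _ => True

/-- Negation is classical at the common event times of synchronised traces, and for guarded
formulae at all times. -/
theorem sat_false_iff {V : Assignment m}
    (hs : ∀ π ρ, V π = some ρ → ∀ t, V.HasTime t → ρ.HasTime t) (φ : QFree m)
    (hd : ∀ π ∈ φ.vars, ∃ ρ, V π = some ρ) (t : ℝ≥0) (h : φ.Guarded ∨ V.HasTime t) :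
    φ.Sat V false t ↔ ¬ φ.Sat V true t := by
  induction φ generalizing t with
  | top => simp [Sat]
  | topOf π =>
    obtain ⟨ρ, hρ⟩ := hd π (by simp [vars])
    simp [Sat, hρ]
  | atom p π =>
    obtain ⟨ρ, hρ⟩ := hd π (by simp [vars])
    have ht : V.HasTime t := h.resolve_left (by simp [Guarded])
    obtain ⟨σ, hσ⟩ := hs π ρ hρ t ht
    have uniq : ∀ σ', (σ', t) ∈ ρ.events → σ' = σ := fun _ h' => ρ.label_unique h' hσ
    simp only [Sat, hρ, Option.mem_def, Option.some.injEq, exists_eq_left', Trace.Fails,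
      Trace.Holds]
    constructor
    · rintro ⟨σ₁, h₁, hp⟩ ⟨σ₂, h₂, hp'⟩
      rw [uniq _ h₁] at hp
      rw [uniq _ h₂] at hp'
      exact hp hp'
    · intro hn
      exact ⟨σ, hσ, fun hp => hn ⟨σ, hσ, hp⟩⟩
  | and φ χ ihφ ihχ =>
    simp only [vars, Finset.mem_union] at hd
    simp only [Guarded] at h
    simp only [Sat]
    rw [ihφ (fun π hπ => hd π (.inl hπ)) t (h.imp_left And.left),
      ihχ (fun π hπ => hd π (.inr hπ)) t (h.imp_left And.right)]
    tauto
  | neg φ ih =>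
    simp only [Sat, Bool.not_false, Bool.not_true]
    rw [ih hd t h, not_not]
  | untl I φ χ ihφ ihχ =>
    simp only [vars, Finset.mem_union] at hd
    have h1 := fun t ht => ihφ (fun π hπ => hd π (.inl hπ)) t (.inr ht)
    have h2 := fun t ht => ihχ (fun π hπ => hd π (.inr hπ)) t (.inr ht)
    simp only [Sat, not_exists, not_and, not_forall]
    refine forall_congr' fun t' => forall_congr' fun _ => forall_congr' fun _ =>
      forall_congr' fun ht' => ?_
    rw [h2 t' ht', ← imp_iff_not_or]
    refine imp_congr_right fun _ => exists_congr fun t'' => ?_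
    simp only [exists_prop]
    exact and_congr_right fun _ => and_congr_right fun _ => and_congr_right fun h => h1 t'' h
  | snce I φ χ ihφ ihχ =>
    simp only [vars, Finset.mem_union] at hd
    have h1 := fun t ht => ihφ (fun π hπ => hd π (.inl hπ)) t (.inr ht)
    have h2 := fun t ht => ihχ (fun π hπ => hd π (.inr hπ)) t (.inr ht)
    simp only [Sat, not_exists, not_and, not_forall]
    refine forall_congr' fun t' => forall_congr' fun _ => forall_congr' fun _ =>
      forall_congr' fun ht' => ?_
    rw [h2 t' ht', ← imp_iff_not_or]
    refine imp_congr_right fun _ => exists_congr fun t'' => ?_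
    simp only [exists_prop]
    exact and_congr_right fun _ => and_congr_right fun _ => and_congr_right fun h => h1 t'' h

end QFree

/-- The additional propositions: the stuttering proposition, the mark on the first position of a
pair, and the marks on the second one, at distance at most `1`, respectively more than `1`. -/
inductive Mark where
  | eps
  | fst
  | near
  | far

instance : Finite Mark :=
  Finite.of_surjective (α := Fin 4) ![.eps, .fst, .near, .far] fun x => by
    cases x
    exacts [⟨0, rfl⟩, ⟨1, rfl⟩, ⟨2, rfl⟩, ⟨3, rfl⟩]

section Traces

variable {C : Type} {m : ℕ}

/-- `ρ` has its `i`-th event at time `T i`, where `1 ≤ i ≤ n`, labelled with the single proposition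
`l i`. The value `none` of `l` stands for the absence of an event; in particular there is none at
the index `0`, which is reserved for the initial time. -/
structure Trace.Reads (e : C ⊕ Mark ≃ Fin m) (ρ : Trace m) (n : ℕ) (T : ℕ → ℝ≥0)
    (l : ℕ → Option (C ⊕ Mark)) : Prop where
  time : ∀ t, ρ.HasTime t ↔ ∃ i, 1 ≤ i ∧ i ≤ n ∧ t = T i
  isSome : ∀ i, (l i).isSome ↔ 1 ≤ i ∧ i ≤ n
  mem : ∀ i p, l i = some p → ({e p}, T i) ∈ ρ.events

/-- Increasing times `0 = T 0 < T 1 < ⋯ < T n`. -/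
structure TimeGrid (n : ℕ) (T : ℕ → ℝ≥0) : Prop where
  zero : T 0 = 0
  lt : ∀ i j, i < j → j ≤ n → T i < T j

theorem TimeGrid.lt_iff {n : ℕ} {T : ℕ → ℝ≥0} (h : TimeGrid n T) {i j : ℕ} (hi : i ≤ n)
    (hj : j ≤ n) : T i < T j ↔ i < j := by
  refine ⟨fun hT => ?_, fun hij => h.lt i j hij hj⟩
  by_contra hij
  rcases (not_lt.1 hij).eq_or_lt with rfl | h'
  · exact lt_irrefl _ hT
  · exact lt_asymm hT (h.lt j i h' hi)

theorem TimeGrid.inj {n : ℕ} {T : ℕ → ℝ≥0} (h : TimeGrid n T) {i j : ℕ} (hi : i ≤ n)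
    (hj : j ≤ n) (hT : T i = T j) : i = j := by
  have h1 := (h.lt_iff hi hj).not
  have h2 := (h.lt_iff hj hi).not
  simp only [hT, lt_self_iff_false, not_false_eq_true, true_iff] at h1 h2
  omega

theorem Trace.Reads.holds_iff {e : C ⊕ Mark ≃ Fin m} {ρ : Trace m} {n : ℕ} {T : ℕ → ℝ≥0}
    {l : ℕ → Option (C ⊕ Mark)} (h : ρ.Reads e n T l) (hT : TimeGrid n T) {i : ℕ} (hi : i ≤ n)
    (p : C ⊕ Mark) : ρ.Holds (T i) (e p) ↔ l i = some p := by
  constructor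
  · rintro ⟨σ, hσ, hp⟩
    obtain ⟨j, hj1, hjn, hj⟩ := (h.time (T i)).1 ⟨σ, hσ⟩
    obtain rfl := hT.inj hi hjn hj
    obtain ⟨q, hq⟩ := Option.isSome_iff_exists.1 ((h.isSome i).2 ⟨hj1, hjn⟩)
    have := ρ.label_unique hσ (h.mem i q hq)
    subst this
    rw [Finset.mem_singleton, e.apply_eq_iff_eq] at hp
    rw [hq, hp]
  · intro hl
    exact ⟨_, h.mem i p hl, by simp⟩

/-- An assignment of traces with the events `T 1, …, T n` to the variables `0`, `1` and `2`. -/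
structure Context (e : C ⊕ Mark ≃ Fin m) (V : Assignment m) (n : ℕ) (T : ℕ → ℝ≥0)
    (l : ℕ → ℕ → Option (C ⊕ Mark)) : Prop where
  grid : TimeGrid n T
  reads : ∀ π, π < 3 → ∃ ρ, V π = some ρ ∧ ρ.Reads e n T (l π)
  dom : ∀ π ρ, V π = some ρ → π < 3

/-- `φ` holds at the event `i`, or at the initial time if `i = 0`. With the bound on `i` built in,
the semantics of the connectives needs no side conditions. -/
def QFree.SatAt (V : Assignment m) (n : ℕ) (T : ℕ → ℝ≥0) (i : ℕ) (φ : QFree m) : Prop :=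
  i ≤ n ∧ φ.Sat V true (T i)

namespace Context

variable {e : C ⊕ Mark ≃ Fin m} {V : Assignment m} {n : ℕ} {T : ℕ → ℝ≥0}
  {l : ℕ → ℕ → Option (C ⊕ Mark)} (hV : Context e V n T l)

include hV

theorem hasTime_iff (t : ℝ≥0) : V.HasTime t ↔ ∃ i, 1 ≤ i ∧ i ≤ n ∧ t = T i := by
  constructor
  · rintro ⟨π, ρ, hρ, ht⟩
    obtain ⟨ρ', hρ', hr⟩ := hV.reads π (hV.dom π ρ hρ)
    obtain rfl : ρ' = ρ := Option.some.inj (hρ'.symm.trans hρ)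
    exact (hr.time t).1 ht
  · intro ht
    obtain ⟨ρ, hρ, hr⟩ := hV.reads 0 (by norm_num)
    exact ⟨0, ρ, hρ, (hr.time t).2 ht⟩

theorem synchronised (π : ℕ) (ρ : Trace m) (hρ : V π = some ρ) (t : ℝ≥0) (ht : V.HasTime t) :
    ρ.HasTime t := by
  obtain ⟨ρ', hρ', hr⟩ := hV.reads π (hV.dom π ρ hρ)
  obtain rfl : ρ' = ρ := Option.some.inj (hρ'.symm.trans hρ)
  exact (hr.time t).2 ((hV.hasTime_iff t).1 ht)

theorem hasTime_T {i : ℕ} (hi : i ≤ n) : V.HasTime (T i) ↔ 1 ≤ i := by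
  rw [hV.hasTime_iff]
  constructor
  · rintro ⟨j, hj, hjn, h⟩
    rwa [hV.grid.inj hi hjn h]
  · exact fun h => ⟨i, h, hi, rfl⟩

theorem satAt_top (i : ℕ) : QFree.SatAt V n T i .top ↔ 1 ≤ i ∧ i ≤ n := by
  unfold QFree.SatAt
  rw [and_comm]
  exact and_congr_left fun hi => hV.hasTime_T hi

theorem satAt_atom {π : ℕ} (hπ : π < 3) (p : C ⊕ Mark) (i : ℕ) :
    QFree.SatAt V n T i (.atom (e p) π) ↔ l π i = some p := by
  obtain ⟨ρ, hρ, hr⟩ := hV.reads π hπ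
  have : ∀ hi : i ≤ n, ((QFree.atom (e p) π).Sat V true (T i) ↔ l π i = some p) := by
    intro hi
    simp [QFree.Sat, hρ, hr.holds_iff hV.grid hi]
  constructor
  · exact fun h => (this h.1).1 h.2
  · intro h
    have hi := ((hr.isSome i).1 (by simp [h])).2
    exact ⟨hi, (this hi).2 h⟩

omit hV in
theorem satAt_and (φ χ : QFree m) (i : ℕ) :
    QFree.SatAt V n T i (.and φ χ) ↔ QFree.SatAt V n T i φ ∧ QFree.SatAt V n T i χ := by
  simp only [QFree.SatAt, QFree.Sat]; tauto

omit hV in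
theorem satAt_or (φ χ : QFree m) (i : ℕ) :
    QFree.SatAt V n T i (φ.or χ) ↔ QFree.SatAt V n T i φ ∨ QFree.SatAt V n T i χ := by
  simp only [QFree.SatAt, QFree.or, QFree.Sat, Bool.not_true, Bool.not_false]; tauto

omit hV in
theorem satAt_bot (i : ℕ) : ¬ QFree.SatAt V n T i .bot := by
  simp [QFree.SatAt, QFree.bot, QFree.Sat]

omit hV in
theorem satAt_disj (L : List (QFree m)) (i : ℕ) :
    QFree.SatAt V n T i (.disj L) ↔ ∃ φ ∈ L, QFree.SatAt V n T i φ := by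
  induction L with
  | nil => simpa [QFree.disj] using satAt_bot i
  | cons φ L ih =>
    rw [show QFree.disj (φ :: L) = φ.or (.disj L) from rfl, satAt_or, ih]
    simp

theorem satAt_neg {φ : QFree m} (hv : φ.vars ⊆ Finset.range 3) {i : ℕ}
    (h : φ.Guarded ∨ 1 ≤ i) : QFree.SatAt V n T i (.neg φ) ↔ i ≤ n ∧ ¬ QFree.SatAt V n T i φ := by
  have : i ≤ n → (φ.Sat V false (T i) ↔ ¬ φ.Sat V true (T i)) := fun hi =>
    QFree.sat_false_iff hV.synchronised φ
      (fun π hπ => (hV.reads π (Finset.mem_range.1 (hv hπ))).imp fun _ h => h.1) _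
      (h.imp_right (hV.hasTime_T hi).2)
  simp only [QFree.SatAt, QFree.Sat, Bool.not_true]
  constructor
  · exact fun h => ⟨h.1, fun h' => (this h.1).1 h.2 h'.2⟩
  · exact fun h => ⟨h.1, (this h.1).2 fun h' => h.2 ⟨h.1, h'⟩⟩

theorem satAt_untl (φ χ : QFree m) (i : ℕ) :
    QFree.SatAt V n T i (.untl .full φ χ) ↔
      ∃ j, i < j ∧ QFree.SatAt V n T j χ ∧ ∀ k, i < k → k < j → QFree.SatAt V n T k φ := by
  simp only [QFree.SatAt, QFree.Sat]
  constructor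
  · rintro ⟨hi, t, ht, -, htime, hχ, hφ⟩
    obtain ⟨j, hj1, hjn, rfl⟩ := (hV.hasTime_iff t).1 htime
    refine ⟨j, (hV.grid.lt_iff hi hjn).1 ht, ⟨hjn, hχ⟩, fun k hik hkj => ?_⟩
    have hkn : k ≤ n := by omega
    exact ⟨hkn, hφ _ (hV.grid.lt _ _ hik hkn) (hV.grid.lt _ _ hkj hjn)
      ((hV.hasTime_T hkn).2 (by omega))⟩
  · rintro ⟨j, hij, ⟨hjn, hχ⟩, hφ⟩
    refine ⟨by omega, T j, hV.grid.lt _ _ hij hjn, by simp [TimeInterval.Mem, TimeInterval.full],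
      (hV.hasTime_T hjn).2 (by omega), hχ, fun t hit htj htime => ?_⟩
    obtain ⟨k, hk1, hkn, rfl⟩ := (hV.hasTime_iff t).1 htime
    exact (hφ k ((hV.grid.lt_iff (by omega) hkn).1 hit) ((hV.grid.lt_iff hkn hjn).1 htj)).2

theorem satAt_next (φ : QFree m) (i : ℕ) :
    QFree.SatAt V n T i φ.next ↔ QFree.SatAt V n T (i + 1) φ := by
  rw [QFree.next, hV.satAt_untl]
  constructor
  · rintro ⟨j, hij, hχ, h⟩
    rcases (Nat.succ_le_of_lt hij).eq_or_lt with rfl | h'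
    · exact hχ
    · exact absurd (h (i + 1) (by omega) h') (satAt_bot _)
  · exact fun h => ⟨i + 1, by omega, h, fun k _ _ => by omega⟩

theorem satAt_eventually (φ : QFree m) (i : ℕ) :
    QFree.SatAt V n T i φ.eventually ↔ ∃ j, i < j ∧ QFree.SatAt V n T j φ := by
  rw [QFree.eventually, hV.satAt_untl]
  refine exists_congr fun j => and_congr_right fun _ => and_iff_left_of_imp fun h k hik hkj => ?_
  rw [hV.satAt_top]
  have := h.1
  omega

end Context

/-! ### The automaton -/

section Automaton

variable [Fintype C] (e : C ⊕ Mark ≃ Fin m)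

/-- The transitions of `marker`. -/
noncomputable def markerTrans : List (Transition m 3 1) :=
  (Finset.univ : Finset C).toList.map (fun c => ⟨0, {e (.inl c)}, .top, ∅, 0⟩) ++
    [⟨0, {e (.inr .eps)}, .top, ∅, 0⟩, ⟨1, {e (.inr .eps)}, .top, ∅, 1⟩,
      ⟨2, {e (.inr .eps)}, .top, ∅, 2⟩, ⟨0, {e (.inr .fst)}, .top, {0}, 1⟩,
      ⟨1, {e (.inr .near)}, .cmp 0 .le 1, {0}, 2⟩, ⟨1, {e (.inr .far)}, .cmp 0 .gt 1, {0}, 2⟩]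

/-- The automaton reading words over `C`, and words in which a position is marked with `fst` and a
later one with `near` or `far`, according to their distance in time; all other positions carry the
stuttering proposition. Its traces with `near` and `far` allow a formula to measure distances. -/
noncomputable def marker : TimedAutomaton m where
  nLoc := 3
  nClk := 1
  init := 0
  trans := markerTrans e
  accepting := Finset.univ

theorem mem_markerTrans {f : Transition m 3 1} : f ∈ markerTrans e ↔
    (∃ c, f = ⟨0, {e (.inl c)}, .top, ∅, 0⟩) ∨ (∃ s, f = ⟨s, {e (.inr .eps)}, .top, ∅, s⟩) ∨
      f = ⟨0, {e (.inr .fst)}, .top, {0}, 1⟩ ∨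
      f = ⟨1, {e (.inr .near)}, .cmp 0 .le 1, {0}, 2⟩ ∨
      f = ⟨1, {e (.inr .far)}, .cmp 0 .gt 1, {0}, 2⟩ := by
  simp only [markerTrans, List.mem_append, List.mem_map, Finset.mem_toList, Finset.mem_univ,
    true_and, List.mem_cons, List.not_mem_nil, or_false]
  refine or_congr (exists_congr fun c => eq_comm) ?_
  constructor
  · rintro (h | h | h | h)
    exacts [.inl ⟨0, h⟩, .inl ⟨1, h⟩, .inl ⟨2, h⟩, .inr h]
  · rintro (⟨s, h⟩ | h)
    · fin_cases s
      exacts [.inl h, .inr (.inl h), .inr (.inr (.inl h))]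
    · exact .inr (.inr (.inr h))

theorem marker_oneClock : (marker e).OneClock := rfl

theorem marker_nonSingular : (marker e).NonSingular := by
  -- Every guard is satisfied by two different clock values.
  have two : ∀ (g : Guard 1) (a b : ℝ≥0), a ≠ b → g.Sat (fun _ => a) → g.Sat (fun _ => b) →
      ¬ ∃ v : Valuation 1, ∀ w : Valuation 1, g.Sat w ↔ w = v := by
    rintro g a b hab ha hb ⟨v, hv⟩
    exact hab (congrFun (((hv _).1 ha).trans ((hv _).1 hb).symm) 0)
  intro f hf
  rcases (mem_markerTrans e).1 hf with ⟨c, rfl⟩ | ⟨s, rfl⟩ | rfl | rfl | rfl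
  · exact two _ 0 1 (by simp) trivial trivial
  · exact two _ 0 1 (by simp) trivial trivial
  · exact two _ 0 1 (by simp) trivial trivial
  · exact two _ 0 1 (by simp) (by simp [Guard.Sat, CmpOp.Sat]) (by simp [Guard.Sat, CmpOp.Sat])
  · refine two _ 2 3 (by norm_num) ?_ ?_ <;> simp only [Guard.Sat, CmpOp.Sat] <;> norm_num

theorem marker_resetOnTesting : (marker e).ResetOnTesting := by
  intro f hf hne x
  have hx : x = (0 : Fin 1) := Subsingleton.elim (α := Fin 1) _ _
  rcases (mem_markerTrans e).1 hf with ⟨c, rfl⟩ | ⟨s, rfl⟩ | rfl | rfl | rfl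
  · exact absurd rfl hne
  · exact absurd rfl hne
  · exact absurd rfl hne
  · rw [hx]; exact Finset.mem_singleton_self _
  · rw [hx]; exact Finset.mem_singleton_self _

theorem marker_hasStutterLoops : (marker e).HasStutterLoops := by
  refine ⟨e (.inr .eps), fun s _ => (mem_markerTrans e).2 (.inr (.inl ⟨s, rfl⟩)),
    fun f hf hε => ?_⟩
  rcases (mem_markerTrans e).1 hf with ⟨c, rfl⟩ | ⟨s, rfl⟩ | rfl | rfl | rfl
  · simp at hε
  · rfl
  all_goals simp at hε

/-- The transitions of `marker`, with the value of the clock at the time of the transition, and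
its location and clock after it. -/
inductive MarkStep (v : ℝ≥0) : Fin 3 → C ⊕ Mark → Fin 3 → ℝ≥0 → Prop
  | cell (c : C) : MarkStep v 0 (.inl c) 0 v
  | eps (s : Fin 3) : MarkStep v s (.inr .eps) s v
  | fst : MarkStep v 0 (.inr .fst) 1 0
  | near (h : v ≤ 1) : MarkStep v 1 (.inr .near) 2 0
  | far (h : 1 < v) : MarkStep v 1 (.inr .far) 2 0

/-- The runs of `marker`, by the value of its only clock. -/
inductive MarkRun : ℝ≥0 → Fin 3 → ℝ≥0 → List (Letter m × ℝ≥0) → Prop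
  | nil (t : ℝ≥0) (s : Fin 3) (v : ℝ≥0) : MarkRun t s v []
  | cons (t t' : ℝ≥0) (s s' : Fin 3) (v v' : ℝ≥0) (p : C ⊕ Mark) (w : List (Letter m × ℝ≥0))
      (step : MarkStep (v + (t' - t)) s p s' v') (rest : MarkRun t' s' v' w) :
      MarkRun t s v (({e p}, t') :: w)

theorem markRun_of_run {t : ℝ≥0} {q q' : (marker e).State} {w : List (Letter m × ℝ≥0)}
    (h : (marker e).Run t q w q') : MarkRun e t q.1 (q.2 (0 : Fin 1)) w := by
  induction h with
  | nil => exact .nil _ _ _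
  | cons t t' v f w q' mem guard rest ih =>
    rcases (mem_markerTrans e).1 mem with ⟨c, rfl⟩ | ⟨s, rfl⟩ | rfl | rfl | rfl
    · exact .cons _ _ _ _ _ _ _ _ (.cell c) ih
    · exact .cons _ _ _ _ _ _ _ _ (.eps s) ih
    · exact .cons _ _ _ _ _ _ _ _ .fst ih
    · exact .cons _ _ _ _ _ _ _ _
        (.near (by simpa [Guard.Sat, CmpOp.Sat, Valuation.delay] using guard)) ih
    · exact .cons _ _ _ _ _ _ _ _
        (.far (by simpa [Guard.Sat, CmpOp.Sat, Valuation.delay] using guard)) ih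

theorem exists_run_of_markRun {t : ℝ≥0} {s : Fin 3} {v : ℝ≥0} {w : List (Letter m × ℝ≥0)}
    (h : MarkRun e t s v w) : ∃ q', (marker e).Run t (s, fun _ => v) w q' := by
  induction h with
  | nil t s v => exact ⟨_, .nil _ _⟩
  | cons t t' s s' v v' p w step rest ih =>
    have key : ∀ f : Transition m 3 1, f ∈ markerTrans e → f.src = s → f.dst = s' →
        f.label = {e p} → f.guard.Sat (fun _ => v + (t' - t)) →
        Valuation.reset (fun _ => v + (t' - t)) f.reset = (fun _ => v') →
        ∃ q', (marker e).Run t (s, fun _ => v) (({e p}, t') :: w) q' := by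
      rintro f hf rfl rfl hl hg hv
      obtain ⟨q', hq⟩ := ih
      rw [← hl]
      have hq' : ∀ u : Valuation 1, u = (fun _ => v') → (marker e).Run t' (f.dst, u) w q' := by
        rintro _ rfl
        exact hq
      exact ⟨q', TimedAutomaton.Run.cons (A := marker e) t t' (fun _ => v) f w q' hf hg
        (hq' _ hv)⟩
    have hzero : Valuation.reset (fun _ : Fin 1 => v + (t' - t)) {0} = fun _ => 0 := by
      funext x
      simp [Valuation.reset, Subsingleton.elim x 0]
    have hkeep : Valuation.reset (fun _ : Fin 1 => v + (t' - t)) ∅ = fun _ => v + (t' - t) := by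
      funext x
      simp [Valuation.reset]
    cases step with
    | cell c => exact key _ ((mem_markerTrans e).2 (.inl ⟨c, rfl⟩)) rfl rfl rfl trivial hkeep
    | eps => exact key _ ((mem_markerTrans e).2 (.inr (.inl ⟨s, rfl⟩))) rfl rfl rfl trivial hkeep
    | fst => exact key _ ((mem_markerTrans e).2 (.inr (.inr (.inl rfl)))) rfl rfl rfl trivial hzero
    | near h =>
      exact key _ ((mem_markerTrans e).2 (.inr (.inr (.inr (.inl rfl))))) rfl rfl rfl
        (by simpa [Guard.Sat, CmpOp.Sat] using h) hzero
    | far h =>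
      exact key _ ((mem_markerTrans e).2 (.inr (.inr (.inr (.inr rfl))))) rfl rfl rfl
        (by simpa [Guard.Sat, CmpOp.Sat] using h) hzero

theorem mem_language_iff (ρ : Trace m) :
    ρ ∈ (marker e).language ↔ MarkRun e 0 0 0 ρ.events := by
  constructor
  · rintro ⟨q, hrun, -⟩
    exact markRun_of_run e hrun
  · intro h
    obtain ⟨q, hq⟩ := exists_run_of_markRun e h
    exact ⟨q, hq, Finset.mem_univ (α := Fin 3) _⟩

omit [Fintype C] in
/-- The distances guaranteed by the marks on a trace of the automaton, for a run that starts in an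
arbitrary state: in location `1` the clock shows the time since the mark `fst`. -/
theorem MarkRun.marks {t : ℝ≥0} {s : Fin 3} {v : ℝ≥0} {w : List (Letter m × ℝ≥0)}
    (h : MarkRun e t s v w) (ht : ∀ a ∈ w, t ≤ a.2) (hw : w.Pairwise (fun a b => a.2 < b.2)) :
    (s = 2 → ∀ a ∈ w, a.1 = {e (.inr .eps)}) ∧
    (s = 1 → ∀ a ∈ w, a.1 ≠ {e (.inr .fst)} ∧
      (a.1 = {e (.inr .near)} → v + (a.2 - t) ≤ 1) ∧
      (a.1 = {e (.inr .far)} → 1 < v + (a.2 - t))) ∧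
    (s = 0 → ∀ a ∈ w, ∀ b ∈ w, a.1 = {e (.inr .fst)} → a.2 < b.2 →
      (b.1 = {e (.inr .near)} → b.2 ≤ a.2 + 1) ∧ (b.1 = {e (.inr .far)} → a.2 + 1 < b.2)) := by
  induction h with
  | nil => simp
  | cons t t' s s' v v' p w step rest ih =>
    have htt' : t ≤ t' := ht _ List.mem_cons_self
    rw [List.pairwise_cons] at hw
    have hlt : ∀ a ∈ w, t' < a.2 := hw.1
    obtain ⟨ih2, ih1, ih0⟩ := ih (fun a ha => (hlt a ha).le) hw.2
    have shift : ∀ a ∈ w, t' - t + (a.2 - t') = a.2 - t := fun a ha => by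
      rw [add_comm, tsub_add_tsub_cancel (hlt a ha).le htt']
    -- A run that stays in location `0` has not met the mark `fst`, which comes in the rest of `w`.
    have later : s' = 0 → p ≠ .inr .fst → ∀ a ∈ (({e p}, t') :: w : List (Letter m × ℝ≥0)),
        ∀ b ∈ (({e p}, t') :: w : List (Letter m × ℝ≥0)), a.1 = {e (.inr .fst)} → a.2 < b.2 →
        (b.1 = {e (.inr .near)} → b.2 ≤ a.2 + 1) ∧
          (b.1 = {e (.inr .far)} → a.2 + 1 < b.2) := by
      intro hs hp a ha b hb h1 h2
      rcases List.mem_cons.1 ha with rfl | ha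
      · exact absurd (by simpa using h1) hp
      rcases List.mem_cons.1 hb with rfl | hb
      · exact absurd h2 (hlt a ha).not_gt
      exact ih0 hs a ha b hb h1 h2
    cases step with
    | cell c => exact ⟨by simp, by simp, fun _ => later rfl (by simp)⟩
    | eps =>
      refine ⟨fun h a ha => ?_, fun h a ha => ?_, fun h => later h (by simp)⟩
      · rcases List.mem_cons.1 ha with rfl | ha
        exacts [rfl, ih2 h a ha]
      · rcases List.mem_cons.1 ha with rfl | ha
        · simp
        · have := ih1 h a ha
          rwa [add_assoc, shift a ha] at this
    | fst =>
      refine ⟨by simp, by simp, fun _ a ha b hb h1 h2 => ?_⟩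
      rcases List.mem_cons.1 ha with rfl | ha
      · rcases List.mem_cons.1 hb with rfl | hb
        · exact absurd h2 (lt_irrefl _)
        have := (ih1 rfl b hb).2
        rwa [zero_add, tsub_le_iff_left, lt_tsub_iff_left] at this
      · exact absurd h1 (ih1 rfl a ha).1
    | near h =>
      refine ⟨by simp, fun _ a ha => ?_, by simp⟩
      rcases List.mem_cons.1 ha with rfl | ha
      · exact ⟨by simp, fun _ => h, by simp⟩
      · simp [ih2 rfl a ha]
    | far h =>
      refine ⟨by simp, fun _ a ha => ?_, by simp⟩
      rcases List.mem_cons.1 ha with rfl | ha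
      · exact ⟨by simp, by simp, fun _ => h⟩
      · simp [ih2 rfl a ha]

omit [Fintype C] in
theorem MarkRun.exists_label {t : ℝ≥0} {s : Fin 3} {v : ℝ≥0} {w : List (Letter m × ℝ≥0)}
    (h : MarkRun e t s v w) : ∀ a ∈ w, ∃ p, a.1 = {e p} := by
  induction h with
  | nil => simp
  | cons t t' s s' v v' p w step rest ih =>
    intro a ha
    rcases List.mem_cons.1 ha with rfl | ha
    exacts [⟨p, rfl⟩, ih a ha]

theorem exists_reads {ρ : Trace m} (hρ : ρ ∈ (marker e).language) {n : ℕ} {T : ℕ → ℝ≥0}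
    (ht : ∀ t, ρ.HasTime t ↔ ∃ i, 1 ≤ i ∧ i ≤ n ∧ t = T i) : ∃ l, ρ.Reads e n T l := by
  have hrun := (mem_language_iff e ρ).1 hρ
  have : ∀ i, ∃ x : Option (C ⊕ Mark), (x.isSome ↔ 1 ≤ i ∧ i ≤ n) ∧
      ∀ p, x = some p → ({e p}, T i) ∈ ρ.events := by
    intro i
    by_cases hi : 1 ≤ i ∧ i ≤ n
    · obtain ⟨σ, hσ⟩ := (ht (T i)).2 ⟨i, hi.1, hi.2, rfl⟩
      obtain ⟨p, hp⟩ := hrun.exists_label e _ hσ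
      refine ⟨some p, by simp [hi], fun p' h => ?_⟩
      obtain rfl := Option.some.inj h
      simp only at hp
      rwa [← hp]
    · exact ⟨none, by simpa using hi, by simp⟩
  choose l hl1 hl2 using this
  exact ⟨l, ht, hl1, hl2⟩

theorem Trace.Reads.near_far {ρ : Trace m} (hρ : ρ ∈ (marker e).language) {n : ℕ} {T : ℕ → ℝ≥0}
    {l : ℕ → Option (C ⊕ Mark)} (h : ρ.Reads e n T l) (hT : TimeGrid n T) {i j : ℕ} (hij : i < j)
    (hi : l i = some (.inr .fst)) :
    (l j = some (.inr .near) → T j ≤ T i + 1) ∧ (l j = some (.inr .far) → T i + 1 < T j) := by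
  have hrun := (mem_language_iff e ρ).1 hρ
  have := (hrun.marks e (by simp) ρ.increasing).2.2 rfl _ (h.mem i _ hi)
  constructor <;> intro hj <;> have hjn := (h.isSome j).1 (by simp [hj]) <;>
    have := this _ (h.mem j _ hj) rfl (hT.lt i j hij hjn.2)
  · exact this.1 rfl
  · exact this.2 rfl

end Automaton

/-! ### Traces with prescribed event times -/

/-- The trace with events `({e (l i)}, T i)`, for `1 ≤ i ≤ n`. -/
def gridTrace (e : C ⊕ Mark ≃ Fin m) {n : ℕ} {T : ℕ → ℝ≥0} (hT : TimeGrid n T)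
    (l : ℕ → C ⊕ Mark) : Trace m where
  events := (List.range' 1 n).map fun i => ({e (l i)}, T i)
  increasing := by
    rw [List.pairwise_map]
    refine List.Pairwise.imp_of_mem (fun {i j} _ hj hij => hT.lt i j hij ?_)
      List.pairwise_lt_range'
    rw [List.mem_range'_1] at hj
    omega

/-- The restriction of a sequence to the indices of events. -/
def clip (n : ℕ) (l : ℕ → C ⊕ Mark) (i : ℕ) : Option (C ⊕ Mark) :=
  if 1 ≤ i ∧ i ≤ n then some (l i) else none

theorem clip_eq_some {n : ℕ} {l : ℕ → C ⊕ Mark} {i : ℕ} {p : C ⊕ Mark} :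
    clip n l i = some p ↔ 1 ≤ i ∧ i ≤ n ∧ l i = p := by
  unfold clip
  split_ifs with h <;> simp [h]
  omega

theorem gridTrace_reads (e : C ⊕ Mark ≃ Fin m) {n : ℕ} {T : ℕ → ℝ≥0} (hT : TimeGrid n T)
    (l : ℕ → C ⊕ Mark) : (gridTrace e hT l).Reads e n T (clip n l) where
  time t := by
    simp only [Trace.HasTime, gridTrace, List.mem_map, List.mem_range'_1, Prod.mk.injEq]
    constructor
    · rintro ⟨σ, i, hi, -, rfl⟩
      exact ⟨i, hi.1, by omega, rfl⟩
    · rintro ⟨i, h1, hn, rfl⟩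
      exact ⟨_, i, ⟨h1, by omega⟩, rfl, rfl⟩
  isSome i := by unfold clip; split_ifs with h <;> simp [h]
  mem i p h := by
    obtain ⟨h1, hn, rfl⟩ := clip_eq_some.1 h
    simp only [gridTrace, List.mem_map, List.mem_range'_1]
    exact ⟨i, ⟨h1, by omega⟩, rfl⟩

/-- The event times of a trace without an event at time `0`. -/
theorem exists_timeGrid (ρ : Trace m) (h0 : ¬ ρ.HasTime 0) : ∃ n T, TimeGrid n T ∧
    ∀ t, ρ.HasTime t ↔ ∃ i, 1 ≤ i ∧ i ≤ n ∧ t = T i := by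
  set L : List ℝ≥0 := 0 :: ρ.events.map Prod.snd with hL
  have hlen : L.length = ρ.events.length + 1 := by simp [hL]
  have hmem : ∀ t, ρ.HasTime t ↔ t ∈ ρ.events.map Prod.snd := by
    intro t; simp [Trace.HasTime]
  have hpw : L.Pairwise (· < ·) := by
    rw [hL, List.pairwise_cons, List.pairwise_map]
    refine ⟨fun t ht => pos_iff_ne_zero.2 ?_, ρ.increasing⟩
    rintro rfl
    exact h0 ((hmem 0).2 ht)
  have hget : ∀ i (h : i < L.length), (if h : i < L.length then L[i] else 0) = L[i] :=
    fun i h => dif_pos h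
  refine ⟨ρ.events.length, fun i => if h : i < L.length then L[i] else 0,
    ⟨hget 0 (by omega), fun i j hij hj => ?_⟩, fun t => ?_⟩
  · rw [hget i (by omega), hget j (by omega)]
    exact List.pairwise_iff_getElem.1 hpw i j _ _ hij
  · rw [hmem, List.mem_iff_getElem]
    constructor
    · rintro ⟨i, hi, rfl⟩
      rw [List.length_map] at hi
      exact ⟨i + 1, by omega, by omega, Eq.trans (by simp [hL]) (hget (i + 1) (by omega)).symm⟩
    · rintro ⟨i, h1, hn, rfl⟩
      obtain ⟨i, rfl⟩ : ∃ j, i = j + 1 := ⟨i - 1, by omega⟩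
      exact ⟨i, by simpa using hn, Eq.trans (by simp [hL]) (hget (i + 1) (by omega)).symm⟩

section Language

variable [Fintype C] (e : C ⊕ Mark ≃ Fin m) {n : ℕ} {T : ℕ → ℝ≥0} (hT : TimeGrid n T)

omit [Fintype C] in
theorem markRun_range' (p : ℕ → C ⊕ Mark) (T : ℕ → ℝ≥0) (s : ℕ → Fin 3) (v : ℕ → ℝ≥0) (k a : ℕ)
    (h : ∀ i, a ≤ i → i < a + k →
      MarkStep (v i + (T (i + 1) - T i)) (s i) (p (i + 1)) (s (i + 1)) (v (i + 1))) :
    MarkRun e (T a) (s a) (v a) ((List.range' (a + 1) k).map fun i => ({e (p i)}, T i)) := by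
  induction k generalizing a with
  | zero => exact .nil _ _ _
  | succ k ih =>
    rw [List.range'_succ, List.map_cons]
    exact .cons _ _ _ _ _ _ _ _ (h a le_rfl (by omega))
      (ih (a + 1) fun i h1 h2 => h i (by omega) (by omega))

theorem gridTrace_mem_language (l : ℕ → C ⊕ Mark) (s : ℕ → Fin 3) (v : ℕ → ℝ≥0)
    (h0 : s 0 = 0) (hv : v 0 = 0)
    (h : ∀ i, i < n →
      MarkStep (v i + (T (i + 1) - T i)) (s i) (l (i + 1)) (s (i + 1)) (v (i + 1))) :
    gridTrace e hT l ∈ (marker e).language := by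
  rw [mem_language_iff]
  have := markRun_range' e l T s v n 0 fun i _ hi => h i (by omega)
  rwa [h0, hv, hT.zero, zero_add] at this

theorem gridTrace_cells_mem (w : ℕ → C) :
    gridTrace e hT (fun i => .inl (w i)) ∈ (marker e).language := by
  refine gridTrace_mem_language e hT _ (fun _ => 0) T rfl hT.zero fun i hi => ?_
  rw [add_tsub_cancel_of_le (hT.lt i (i + 1) (by omega) hi).le]
  exact .cell _

/-- The sequence with `fst` at `i`, with `x` at `j`, and stuttering elsewhere. -/
def markAt (i j : ℕ) (x : Mark) (k : ℕ) : C ⊕ Mark :=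
  .inr (if k = i then .fst else if k = j then x else .eps)

theorem gridTrace_markAt_mem {i j : ℕ} (hi : 1 ≤ i) (hij : i < j) {x : Mark}
    (h : x = .near ∧ T j ≤ T i + 1 ∨ x = .far ∧ T i + 1 < T j) :
    gridTrace e hT (markAt i j x) ∈ (marker e).language := by
  refine gridTrace_mem_language e hT _ (fun k => if k < i then 0 else if k < j then 1 else 2)
    (fun k => if k < i then T k else if k < j then T k - T i else T k - T j)
    (if_pos hi) (by rw [if_pos (by omega), hT.zero]) fun k hk => ?_
  have hkk := (hT.lt k (k + 1) (by omega) hk).le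
  have shift : ∀ a, a ≤ k → T k - T a + (T (k + 1) - T k) = T (k + 1) - T a := fun a ha => by
    have : T a ≤ T k := by
      rcases ha.eq_or_lt with rfl | ha
      exacts [le_rfl, (hT.lt a k ha hk.le).le]
    rw [add_comm, tsub_add_tsub_cancel hkk this]
  rcases lt_trichotomy (k + 1) i with h1 | h1 | h1
  · simp only [markAt, show k < i by omega, h1, if_true, show k + 1 ≠ i by omega,
      show k + 1 ≠ j by omega, if_false, add_tsub_cancel_of_le hkk]
    exact .eps _
  · simp only [markAt, show k < i by omega, h1, if_true, lt_irrefl, if_false, hij, tsub_self]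
    exact .fst
  · have hki : ¬ k < i := by omega
    have hki' : ¬ k + 1 < i := by omega
    rcases lt_trichotomy (k + 1) j with h2 | h2 | h2
    · simp only [markAt, hki, hki', h2, show k < j by omega, if_true, h1.ne',
        h2.ne, if_false, shift i (by omega)]
      exact .eps _
    · simp only [markAt, hki, hki', show k < j by omega, if_true, if_false, shift i (by omega)]
      simp only [h2, hij.ne', lt_irrefl, if_true, if_false, tsub_self]
      rcases h with ⟨rfl, h⟩ | ⟨rfl, h⟩
      · exact .near (tsub_le_iff_left.2 h)
      · exact .far (lt_tsub_iff_left.2 h)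
    · simp only [markAt, hki, hki', show ¬ k < j by omega, show ¬ k + 1 < j by omega, h1.ne',
        h2.ne', if_false, shift j (by omega)]
      exact .eps _

end Language

end Traces

/-! ### The specification -/

/-- Untimed formulae over the variables `0`, `1` and `2`. -/
def QFree.Plain {m : ℕ} (φ : QFree m) : Prop := φ.IsLTL ∧ φ.vars ⊆ Finset.range 3

namespace QFree.Plain

variable {m : ℕ} {φ χ : QFree m}

theorem top : (QFree.top : QFree m).Plain := ⟨trivial, by simp [vars]⟩

theorem atom (p : Fin m) {π : ℕ} (hπ : π < 3) : (QFree.atom p π).Plain :=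
  ⟨trivial, by simpa [vars] using hπ⟩

theorem and (hφ : φ.Plain) (hχ : χ.Plain) : (QFree.and φ χ).Plain :=
  ⟨⟨hφ.1, hχ.1⟩, Finset.union_subset hφ.2 hχ.2⟩

theorem neg (hφ : φ.Plain) : (QFree.neg φ).Plain := hφ

theorem untl (hφ : φ.Plain) (hχ : χ.Plain) : (QFree.untl .full φ χ).Plain :=
  ⟨⟨rfl, hφ.1, hχ.1⟩, Finset.union_subset hφ.2 hχ.2⟩

theorem bot : (QFree.bot : QFree m).Plain := top.and top.neg

theorem next (hφ : φ.Plain) : φ.next.Plain := bot.untl hφ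

theorem eventually (hφ : φ.Plain) : φ.eventually.Plain := top.untl hφ

theorem disj {L : List (QFree m)} (h : ∀ φ ∈ L, φ.Plain) : (QFree.disj L).Plain := by
  induction L with
  | nil => exact bot
  | cons φ L ih =>
    rw [List.forall_mem_cons] at h
    exact (h.1.neg.and (ih h.2).neg).neg

end QFree.Plain

theorem QFree.guarded_disj {m : ℕ} {L : List (QFree m)} (h : ∀ φ ∈ L, φ.Guarded) :
    (QFree.disj L).Guarded := by
  induction L with
  | nil => exact ⟨trivial, trivial⟩
  | cons φ L ih =>
    rw [List.forall_mem_cons] at h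
    exact ⟨h.1, ih h.2⟩

section Spec

variable {C : Type} [Fintype C] {m : ℕ} (e : C ⊕ Mark ≃ Fin m) (D : TileSystem C)

/-- The trace of the variable `0` has the letter `c`. -/
def cellF (c : C) : QFree m := .atom (e (.inl c)) 0

/-- The trace of the variable `π` has the mark `x`. -/
def markF (x : Mark) (π : ℕ) : QFree m := .atom (e (.inr x)) π

open Classical in
/-- The trace of the variable `0` has a letter satisfying `P`. -/
noncomputable def oneOf (P : C → Prop) : QFree m :=
  .disj ((Finset.univ.filter P).toList.map (cellF e))

/-- The following letters are those of `u`, then blanks, then a starting letter that is not the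
last one. -/
noncomputable def prefixF : List C → QFree m
  | [] => .untl .full (cellF e D.blank) (.and (oneOf e D.start) (.next .top))
  | c :: u => .next (.and (cellF e c) (prefixF u))

open Classical in
/-- The situations that must not occur. The variable `1` stands for a trace measuring a distance
of at most `1`, and the variable `2` for a trace measuring a distance of more than `1`. -/
noncomputable def violations : List (QFree m) :=
  [
    -- some event carries no letter
    .eventually (.neg (oneOf e fun _ => True)),
    -- positions at distance at most `1`, whose successors are at distance more than `1`
    .eventually (.and (markF e .fst 1) (.and (.next (markF e .fst 2))
      (.eventually (.and (markF e .near 1) (.next (markF e .far 2)))))),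
    -- positions at distance more than `1`, whose successors are at distance at most `1`
    .eventually (.and (markF e .fst 2) (.and (.next (markF e .fst 1))
      (.eventually (.and (markF e .far 2) (.next (markF e .near 1)))))),
    -- the letter after the start of a later row is at distance at most `1` from the first letter
    .next (.and (markF e .fst 1)
      (.eventually (.and (oneOf e D.start) (.next (markF e .near 1))))),
    -- the start of the second row is at distance more than `1` from the first letter
    .next (.and (markF e .fst 2)
      (.untl .full (oneOf e fun c => ¬ D.start c) (.and (oneOf e D.start) (markF e .far 2)))),
    -- the local relation fails
    .disj ((Finset.univ.filter fun c : C × C × C × C =>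
      ¬ D.rel c.1 c.2.1 c.2.2.1 c.2.2.2).toList.map fun c =>
        .eventually (.and (.and (markF e .fst 1) (markF e .fst 2)) (.and (.and (cellF e c.1) (.next (cellF e c.2.1)))
          (.eventually (.and (.and (markF e .near 1) (cellF e c.2.2.1))
            (.next (.and (markF e .far 2) (cellF e c.2.2.2))))))))]

/-- The part of the specification that does not depend on the first row. -/
noncomputable def mainF : QFree m :=
  .and (.neg .top) (.and (.eventually (.and (oneOf e D.final) (.next .top)))
    (.neg (.disj (violations e D))))

/-- The quantifier-free specification of a tiling with first row `u`. -/
noncomputable def bodyF (u : List C) : QFree m := .and (prefixF e D u) (mainF e D)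

omit [Fintype C] in
theorem cellF_plain (c : C) : (cellF e c).Plain := .atom _ (by norm_num)

omit [Fintype C] in
theorem markF_plain (x : Mark) {π : ℕ} (hπ : π < 3) : (markF e x π).Plain := .atom _ hπ

theorem oneOf_plain (P : C → Prop) : (oneOf e P).Plain := by
  refine .disj fun φ hφ => ?_
  obtain ⟨c, -, rfl⟩ := List.mem_map.1 hφ
  exact cellF_plain e c

theorem prefixF_plain (u : List C) : (prefixF e D u).Plain := by
  induction u with
  | nil => exact .untl (cellF_plain e _) (.and (oneOf_plain e _) (.next .top))
  | cons c u ih => exact .next (.and (cellF_plain e c) ih)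

theorem violations_plain : ∀ φ ∈ violations e D, φ.Plain := by
  have h1 := fun x => markF_plain (C := C) e x (π := 1) (by norm_num)
  have h2 := fun x => markF_plain (C := C) e x (π := 2) (by norm_num)
  simp only [violations, List.forall_mem_cons, List.not_mem_nil, IsEmpty.forall_iff, implies_true,
    and_true]
  refine ⟨.eventually (.neg (oneOf_plain e _)),
    .eventually (.and (h1 _) (.and (.next (h2 _)) (.eventually (.and (h1 _) (.next (h2 _)))))),
    .eventually (.and (h2 _) (.and (.next (h1 _)) (.eventually (.and (h2 _) (.next (h1 _)))))),
    .next (.and (h1 _) (.eventually (.and (oneOf_plain e _) (.next (h1 _))))),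
    .next (.and (h2 _) (.untl (oneOf_plain e _) (.and (oneOf_plain e _) (h2 _)))),
    .disj fun φ hφ => ?_⟩
  obtain ⟨c, -, rfl⟩ := List.mem_map.1 hφ
  exact .eventually (.and (.and (h1 _) (h2 _)) (.and (.and (cellF_plain e _)
    (.next (cellF_plain e _))) (.eventually (.and (.and (h1 _) (cellF_plain e _))
      (.next (.and (h2 _) (cellF_plain e _)))))))

theorem bodyF_plain (u : List C) : (bodyF e D u).Plain :=
  .and (prefixF_plain e D u) (.and (.neg .top) (.and (.eventually (.and (oneOf_plain e _)
    (.next .top))) (.neg (.disj (violations_plain e D)))))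

theorem violations_guarded : (QFree.disj (violations e D)).Guarded := by
  refine QFree.guarded_disj ?_
  simp only [violations, List.forall_mem_cons, List.not_mem_nil, IsEmpty.forall_iff, implies_true,
    and_true]
  refine ⟨trivial, trivial, trivial, trivial, trivial, QFree.guarded_disj fun φ hφ => ?_⟩
  obtain ⟨c, -, rfl⟩ := List.mem_map.1 hφ
  exact trivial

theorem bodyF_guarded (u : List C) : (bodyF e D u).Guarded := by
  refine ⟨?_, trivial, trivial, violations_guarded e D⟩
  cases u <;> trivial

/-- The meaning of `bodyF` for the label sequences `l 0`, `l 1`, `l 2` of the three traces. -/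
structure Correct (n : ℕ) (u : List C) (l : ℕ → ℕ → Option (C ⊕ Mark)) : Prop where
  row : ∀ i (h : i < u.length), l 0 (i + 1) = some (.inl u[i])
  width : ∃ j, u.length < j ∧ (∃ c, D.start c ∧ l 0 j = some (.inl c)) ∧ j + 1 ≤ n ∧
    ∀ i, u.length < i → i < j → l 0 i = some (.inl D.blank)
  cells : ∀ i, 1 ≤ i → i ≤ n → ∃ c, l 0 i = some (.inl c)
  final : ∃ i c, D.final c ∧ l 0 i = some (.inl c) ∧ i + 1 ≤ n
  near_succ : ∀ i j, i < j → l 1 i = some (.inr .fst) → l 2 (i + 1) = some (.inr .fst) →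
    l 1 j = some (.inr .near) → l 2 (j + 1) ≠ some (.inr .far)
  far_succ : ∀ i j, i < j → l 2 i = some (.inr .fst) → l 1 (i + 1) = some (.inr .fst) →
    l 2 j = some (.inr .far) → l 1 (j + 1) ≠ some (.inr .near)
  width_le : l 1 1 = some (.inr .fst) → ∀ j c, 1 < j → D.start c → l 0 j = some (.inl c) →
    l 1 (j + 1) ≠ some (.inr .near)
  le_width : l 2 1 = some (.inr .fst) → ∀ j c, 1 < j → D.start c → l 0 j = some (.inl c) →
    (∀ k, 1 < k → k < j → ∃ c, ¬ D.start c ∧ l 0 k = some (.inl c)) → l 2 j ≠ some (.inr .far)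
  rel : ∀ i j x y z t, i < j → l 1 i = some (.inr .fst) → l 2 i = some (.inr .fst) →
    l 1 j = some (.inr .near) → l 2 (j + 1) = some (.inr .far) →
    l 0 i = some (.inl x) → l 0 (i + 1) = some (.inl y) → l 0 j = some (.inl z) →
    l 0 (j + 1) = some (.inl t) → D.rel x y z t

variable {e} {V : Assignment m} {n : ℕ} {T : ℕ → ℝ≥0} {l : ℕ → ℕ → Option (C ⊕ Mark)}
  (hV : Context e V n T l)

namespace Context

include hV

omit [Fintype C] in
theorem satAt_cellF (c : C) (i : ℕ) :
    QFree.SatAt V n T i (cellF e c) ↔ l 0 i = some (.inl c) :=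
  hV.satAt_atom (by norm_num) _ i

omit [Fintype C] in
theorem satAt_markF (x : Mark) {π : ℕ} (hπ : π < 3) (i : ℕ) :
    QFree.SatAt V n T i (markF e x π) ↔ l π i = some (.inr x) :=
  hV.satAt_atom hπ _ i

omit [Fintype C] in
theorem pos {π i : ℕ} {p : C ⊕ Mark} (h : l π i = some p) (hπ : π < 3 := by norm_num) : 0 < i := by
  obtain ⟨ρ, -, hr⟩ := hV.reads π hπ
  exact ((hr.isSome i).1 (by simp [h])).1

theorem satAt_oneOf (P : C → Prop) (i : ℕ) :
    QFree.SatAt V n T i (oneOf e P) ↔ ∃ c, P c ∧ l 0 i = some (.inl c) := by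
  simp [oneOf, satAt_disj, hV.satAt_cellF]

theorem satAt_prefixF (u : List C) (k : ℕ) :
    QFree.SatAt V n T k (prefixF e D u) ↔
      (∀ i (h : i < u.length), l 0 (k + i + 1) = some (.inl u[i])) ∧
      ∃ j, k + u.length < j ∧ (∃ c, D.start c ∧ l 0 j = some (.inl c)) ∧ j + 1 ≤ n ∧
        ∀ i, k + u.length < i → i < j → l 0 i = some (.inl D.blank) := by
  induction u generalizing k with
  | nil =>
    simp only [prefixF, hV.satAt_untl, satAt_and, hV.satAt_oneOf, hV.satAt_next, hV.satAt_top,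
      hV.satAt_cellF, List.length_nil, Nat.add_zero, Nat.not_lt_zero, IsEmpty.forall_iff,
      implies_true, true_and]
    refine exists_congr fun j => and_congr_right fun _ => ?_
    rw [and_assoc]
    exact and_congr_right fun _ => and_congr_left fun _ => and_iff_right (by omega)
  | cons c u ih =>
    simp only [prefixF, hV.satAt_next, satAt_and, hV.satAt_cellF, ih, List.length_cons]
    rw [← and_assoc, show k + 1 + u.length = k + (u.length + 1) by ring]
    refine and_congr_left fun _ => ⟨fun h i hi => ?_, fun h => ⟨h 0 (by omega), fun i hi => ?_⟩⟩
    · cases i with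
      | zero => exact h.1
      | succ i =>
        rw [show k + (i + 1) + 1 = k + 1 + i + 1 by ring]
        exact h.2 i (by omega)
    · rw [show k + 1 + i + 1 = k + (i + 1) + 1 by ring]
      exact h (i + 1) (by omega)

theorem satAt_bodyF (u : List C) : QFree.SatAt V n T 0 (bodyF e D u) ↔ Correct D n u l := by
  have m1 := fun x => hV.satAt_markF x (π := 1) (by norm_num)
  have m2 := fun x => hV.satAt_markF x (π := 2) (by norm_num)
  have htop : QFree.SatAt V n T 0 (.neg .top) := by
    rw [hV.satAt_neg QFree.Plain.top.2 (.inl trivial), hV.satAt_top]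
    exact ⟨Nat.zero_le n, by omega⟩
  have hcell : ∀ j, 0 < j ∧ QFree.SatAt V n T j (.neg (oneOf e fun _ => True)) ↔
      1 ≤ j ∧ j ≤ n ∧ ∀ c, l 0 j ≠ some (.inl c) := by
    intro j
    refine and_congr_right fun hj => ?_
    rw [hV.satAt_neg (oneOf_plain e _).2 (.inr hj), hV.satAt_oneOf]
    simp
  rw [bodyF, satAt_and, mainF, satAt_and, satAt_and, and_iff_right htop, hV.satAt_prefixF,
    hV.satAt_neg (QFree.Plain.disj (violations_plain e D)).2 (.inl (violations_guarded e D)),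
    satAt_disj, and_iff_right (Nat.zero_le n)]
  simp only [violations, List.exists_mem_cons_iff, List.not_mem_nil, false_and, exists_false,
    or_false, hV.satAt_eventually, hV.satAt_next, hV.satAt_untl, satAt_and, m1, m2,
    hV.satAt_oneOf, satAt_disj, List.mem_map, Finset.mem_toList, Finset.mem_filter,
    Finset.mem_univ, true_and, hV.satAt_top, hcell, Nat.zero_add, not_or]
  constructor
  · rintro ⟨⟨h1, h2⟩, ⟨i, -, ⟨c, hc, hi⟩, -, hin⟩, v1, v2, v3, v4, v5, v6⟩
    refine ⟨h1, h2, ?_, ⟨i, c, hc, hi, hin⟩, ?_, ?_, ?_, ?_, ?_⟩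
    · intro i h1 hn
      by_contra hne
      exact v1 ⟨i, h1, hn, fun c hc => hne ⟨c, hc⟩⟩
    · intro i j hij h1 h2 h3 h4
      have := hV.pos h1
      exact v2 ⟨i, this, h1, h2, j, hij, h3, h4⟩
    · intro i j hij h1 h2 h3 h4
      have := hV.pos h1
      exact v3 ⟨i, this, h1, h2, j, hij, h3, h4⟩
    · intro h1 j c hj hc hjc h2
      exact v4 ⟨h1, j, hj, ⟨c, hc, hjc⟩, h2⟩
    · intro h1 j c hj hc hjc hk h2
      exact v5 ⟨h1, j, hj, ⟨⟨c, hc, hjc⟩, h2⟩, hk⟩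
    · intro i j x y z t hij a1 a2 a3 a4 hx hy hz ht
      by_contra hr
      refine v6 ⟨_, ⟨(x, y, z, t), hr, rfl⟩, ?_⟩
      simp only [hV.satAt_eventually, hV.satAt_next, satAt_and, m1, m2, hV.satAt_cellF]
      exact ⟨i, hV.pos a1, ⟨a1, a2⟩, ⟨hx, hy⟩, j, hij, ⟨a3, hz⟩, a4, ht⟩
  · intro h
    refine ⟨⟨h.row, h.width⟩, ?_, ?_, ?_, ?_, ?_, ?_, ?_⟩
    · obtain ⟨i, c, hc, hi, hin⟩ := h.final
      exact ⟨i, hV.pos hi, ⟨c, hc, hi⟩, by omega, hin⟩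
    · rintro ⟨i, h1, hn, hc⟩
      obtain ⟨c, hc'⟩ := h.cells i h1 hn
      exact hc c hc'
    · rintro ⟨i, -, h1, h2, j, hij, h3, h4⟩
      exact h.near_succ i j hij h1 h2 h3 h4
    · rintro ⟨i, -, h1, h2, j, hij, h3, h4⟩
      exact h.far_succ i j hij h1 h2 h3 h4
    · rintro ⟨h1, j, hj, ⟨c, hc, hjc⟩, h2⟩
      exact h.width_le h1 j c hj hc hjc h2
    · rintro ⟨h1, j, hj, ⟨⟨c, hc, hjc⟩, h2⟩, hk⟩
      exact h.le_width h1 j c hj hc hjc hk h2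
    · rintro ⟨_, ⟨⟨x, y, z, t⟩, hr, rfl⟩, hs⟩
      simp only [hV.satAt_eventually, hV.satAt_next, satAt_and, m1, m2, hV.satAt_cellF] at hs
      obtain ⟨i, -, ⟨a1, a2⟩, ⟨hx, hy⟩, j, hij, ⟨a3, hz⟩, a4, ht⟩ := hs
      exact hr (h.rel i j x y z t hij a1 a2 a3 a4 hx hy hz ht)

end Context

end Spec

/-! ### Correctness of the specification -/

section Equivalence

variable {C : Type} {m : ℕ}

/-- The assignment of three traces to the variables `0`, `1` and `2`. -/
def assign (ρ₀ ρ₁ ρ₂ : Trace m) : Assignment m :=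
  Function.update (Function.update (Function.update (fun _ => none) 0 (some ρ₀)) 1 (some ρ₁)) 2
    (some ρ₂)

/-- The label sequences of three traces, indexed by variables. -/
def labels (l₀ l₁ l₂ : ℕ → Option (C ⊕ Mark)) : ℕ → ℕ → Option (C ⊕ Mark)
  | 0 => l₀
  | 1 => l₁
  | _ => l₂

theorem assign_apply (ρ₀ ρ₁ ρ₂ : Trace m) (π : ℕ) : assign ρ₀ ρ₁ ρ₂ π =
    if π = 2 then some ρ₂ else if π = 1 then some ρ₁ else if π = 0 then some ρ₀ else none := by
  simp only [assign, Function.update_apply]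

theorem context_assign {e : C ⊕ Mark ≃ Fin m} {ρ₀ ρ₁ ρ₂ : Trace m} {n : ℕ} {T : ℕ → ℝ≥0}
    {l₀ l₁ l₂ : ℕ → Option (C ⊕ Mark)} (hT : TimeGrid n T) (h₀ : ρ₀.Reads e n T l₀)
    (h₁ : ρ₁.Reads e n T l₁) (h₂ : ρ₂.Reads e n T l₂) :
    Context e (assign ρ₀ ρ₁ ρ₂) n T (labels l₀ l₁ l₂) where
  grid := hT
  reads π hπ := by
    interval_cases π
    exacts [⟨ρ₀, rfl, h₀⟩, ⟨ρ₁, rfl, h₁⟩, ⟨ρ₂, rfl, h₂⟩]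
  dom π ρ h := by
    rw [assign_apply] at h
    by_contra hπ
    rw [if_neg (by omega), if_neg (by omega), if_neg (by omega)] at h
    cases h

/-- The sentence `∃ 0 ∀ 1 ∀ 2, ψ`. -/
def existsForall (ψ : QFree m) : Formula m := .ex 0 (.all 1 (.all 2 (.qfree ψ)))

/-- The sentence `∀ 0 ∃ 1 ∃ 2, ψ`. -/
def forallExists (ψ : QFree m) : Formula m := .all 0 (.ex 1 (.ex 2 (.qfree ψ)))

theorem synchronises_none (ρ : Trace m) : Assignment.Synchronises (fun _ => none) ρ := by
  intro π ρ' h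
  cases h

theorem synchronises_update {V : Assignment m} {π : ℕ} (hπ : V π = none) (ρ ρ' : Trace m) :
    Assignment.Synchronises (Function.update V π (some ρ)) ρ' ↔
      V.Synchronises ρ' ∧ ∀ t, ρ.HasTime t ↔ ρ'.HasTime t := by
  constructor
  · refine fun h => ⟨fun π' ρ'' hρ => h π' ρ'' ?_, h π ρ (by simp)⟩
    have : π' ≠ π := by
      rintro rfl
      rw [hπ] at hρ
      cases hρ
    simpa [this] using hρ
  · rintro ⟨h1, h2⟩ π' ρ'' hρ
    rcases eq_or_ne π' π with rfl | hne
    · obtain rfl : ρ = ρ'' := by simpa using hρ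
      exact h2
    · exact h1 π' ρ'' (by simpa [hne] using hρ)

theorem modelsSync_existsForall (L : Set (Trace m)) (ψ : QFree m) :
    ModelsSync L (existsForall ψ) ↔ ∃ ρ₀ ∈ L, ∀ ρ₁ ∈ L, (∀ t, ρ₀.HasTime t ↔ ρ₁.HasTime t) →
      ∀ ρ₂ ∈ L, (∀ t, ρ₀.HasTime t ↔ ρ₂.HasTime t) → ψ.Sat (assign ρ₀ ρ₁ ρ₂) true 0 := by
  simp only [ModelsSync, existsForall, Formula.SatSync, synchronises_none, true_and]
  refine exists_congr fun ρ₀ => and_congr_right fun _ => forall_congr' fun ρ₁ =>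
    forall_congr' fun _ => ?_
  rw [synchronises_update rfl, and_iff_right (synchronises_none ρ₁)]
  refine forall_congr' fun h₁ => forall_congr' fun ρ₂ => forall_congr' fun _ => ?_
  rw [synchronises_update (by simp), synchronises_update rfl,
    and_iff_right (synchronises_none ρ₂)]
  exact ⟨fun h h₂ => h ⟨h₂, fun t => (h₁ t).symm.trans (h₂ t)⟩, fun h h₂ => h h₂.1⟩

theorem modelsSync_forallExists (L : Set (Trace m)) (ψ : QFree m) :
    ModelsSync L (forallExists ψ) ↔ ∀ ρ₀ ∈ L, ∃ ρ₁ ∈ L, (∀ t, ρ₀.HasTime t ↔ ρ₁.HasTime t) ∧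
      ∃ ρ₂ ∈ L, (∀ t, ρ₀.HasTime t ↔ ρ₂.HasTime t) ∧ ψ.Sat (assign ρ₀ ρ₁ ρ₂) true 0 := by
  simp only [ModelsSync, forallExists, Formula.SatSync, synchronises_none, true_imp_iff]
  refine forall_congr' fun ρ₀ => forall_congr' fun _ => exists_congr fun ρ₁ =>
    and_congr_right fun _ => ?_
  rw [synchronises_update rfl, and_iff_right (synchronises_none ρ₁)]
  refine and_congr_right fun h₁ => exists_congr fun ρ₂ => and_congr_right fun _ => ?_
  rw [synchronises_update (by simp), synchronises_update rfl,
    and_iff_right (synchronises_none ρ₂)]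
  exact ⟨fun h => ⟨h.1.1, h.2⟩, fun h => ⟨⟨h.1, fun t => (h₁ t).symm.trans (h.1 t)⟩, h.2⟩⟩

/-- For guarded formulae, the negation normal form expresses the classical negation of a sentence
in the synchronous semantics. -/
theorem modelsSync_forallExists_neg (L : Set (Trace m)) {ψ : QFree m} (hg : ψ.Guarded)
    (hv : ψ.vars ⊆ Finset.range 3) :
    ModelsSync L (forallExists (.neg ψ)) ↔ ¬ ModelsSync L (existsForall ψ) := by
  rw [modelsSync_forallExists, modelsSync_existsForall]
  push Not
  refine forall_congr' fun ρ₀ => forall_congr' fun _ => exists_congr fun ρ₁ =>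
    and_congr_right fun _ => and_congr_right fun h₁ => exists_congr fun ρ₂ =>
    and_congr_right fun _ => and_congr_right fun h₂ => ?_
  refine QFree.sat_false_iff (fun π ρ hρ t ht => ?_) ψ (fun π hπ => ?_) 0 (.inl hg)
  · have key : ∀ π ρ, assign ρ₀ ρ₁ ρ₂ π = some ρ → (ρ₀.HasTime t ↔ ρ.HasTime t) := by
      intro π ρ hρ
      rw [assign_apply] at hρ
      split_ifs at hρ
      all_goals
        obtain rfl := Option.some.inj hρ
        first | exact h₂ t | exact h₁ t | exact Iff.rfl
    obtain ⟨π', ρ', hρ', ht'⟩ := ht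
    exact (key π ρ hρ).1 ((key π' ρ' hρ').2 ht')
  · have := Finset.mem_range.1 (hv hπ)
    interval_cases π
    exacts [⟨_, rfl⟩, ⟨_, rfl⟩, ⟨_, rfl⟩]

variable [Fintype C] (e : C ⊕ Mark ≃ Fin m) (D : TileSystem C)

omit [Fintype C] in
theorem clip_markAt_fst {n i j : ℕ} (x : Mark) (hi : 1 ≤ i) (hn : i ≤ n) :
    clip n (markAt (C := C) i j x) i = some (.inr .fst) :=
  clip_eq_some.2 ⟨hi, hn, by simp [markAt]⟩

omit [Fintype C] in
theorem clip_markAt_snd {n i j : ℕ} (x : Mark) (hij : i < j) (hn : j ≤ n) :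
    clip n (markAt (C := C) i j x) j = some (.inr x) :=
  clip_eq_some.2 ⟨by omega, hn, by simp [markAt, hij.ne']⟩

/-- If the specification is correct for all choices of the two measuring traces, then being at
distance at most `1` is invariant under shifts, and the events are arranged in rows of equal
length. -/
theorem hasTiling_of_correct {u : List C} (hu : u ≠ [])
    (htail : ∀ i (h : i < u.length), 0 < i → ¬ D.start u[i]) (hblank : ¬ D.start D.blank)
    {n : ℕ} {T : ℕ → ℝ≥0} (hT : TimeGrid n T) {ρ₀ : Trace m} (hρ₀ : ρ₀ ∈ (marker e).language)
    {l₀ : ℕ → Option (C ⊕ Mark)} (h₀ : ρ₀.Reads e n T l₀)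
    (H : ∀ l₁ l₂ ρ₁ ρ₂, ρ₁ ∈ (marker e).language → ρ₂ ∈ (marker e).language →
      Trace.Reads e ρ₁ n T l₁ → Trace.Reads e ρ₂ n T l₂ → Correct D n u (labels l₀ l₁ l₂)) :
    D.HasTiling u := by
  have hC := H l₀ l₀ ρ₀ ρ₀ hρ₀ hρ₀ h₀ h₀
  have hu0 : 0 < u.length := List.length_pos_iff.2 hu
  obtain ⟨w, hw⟩ : ∃ w : ℕ → C, ∀ i, i < n → l₀ (i + 1) = some (.inl (w i)) := by
    have : ∀ i, ∃ c, i < n → l₀ (i + 1) = some (.inl c) := by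
      intro i
      by_cases hi : i < n
      · obtain ⟨c, hc⟩ := hC.cells (i + 1) (by omega) hi
        exact ⟨c, fun _ => hc⟩
      · exact ⟨D.blank, fun h => absurd h hi⟩
    exact ⟨fun i => (this i).choose, fun i => (this i).choose_spec⟩
  have hw_eq : ∀ i c, i < n → l₀ (i + 1) = some (.inl c) → w i = c := by
    intro i c hi h
    rw [hw i hi] at h
    exact Sum.inl.inj (Option.some.inj h)
  have near : ∀ i j, 1 ≤ i → i < j → T j ≤ T i + 1 →
      gridTrace e hT (markAt i j .near) ∈ (marker e).language :=
    fun i j hi hij h => gridTrace_markAt_mem e hT hi hij (.inl ⟨rfl, h⟩)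
  have far : ∀ i j, 1 ≤ i → i < j → T i + 1 < T j →
      gridTrace e hT (markAt i j .far) ∈ (marker e).language :=
    fun i j hi hij h => gridTrace_markAt_mem e hT hi hij (.inr ⟨rfl, h⟩)
  have reads := fun i j x => gridTrace_reads e hT (markAt i j x)
  obtain ⟨j, hj, ⟨cs, hcs, hjs⟩, hjn, hbl⟩ := hC.width
  obtain ⟨s, rfl⟩ : ∃ s, j = s + 1 := ⟨j - 1, by omega⟩
  -- The start of the second row is within distance `1` of the first letter, its successor is not.
  have base1 : T (1 + s) ≤ T 1 + 1 := by
    by_contra h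
    rw [add_comm 1 s] at h
    refine (H l₀ _ ρ₀ _ hρ₀ (far 1 (s + 1) le_rfl (by omega) (not_le.1 h)) h₀
      (reads _ _ _)).le_width
      (clip_markAt_fst _ le_rfl (by omega)) (s + 1) cs (by omega) hcs hjs (fun k hk1 hks => ?_)
      (clip_markAt_snd _ (by omega) (by omega))
    obtain ⟨k, rfl⟩ : ∃ k', k = k' + 1 := ⟨k - 1, by omega⟩
    rcases lt_or_ge k u.length with hk | hk
    · exact ⟨_, htail k hk (by omega), hC.row k hk⟩
    · exact ⟨_, hblank, hbl (k + 1) (by omega) hks⟩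
  have base2 : T 1 + 1 < T (1 + s + 1) := by
    by_contra h
    rw [show 1 + s + 1 = s + 1 + 1 by ring] at h
    exact (H _ l₀ _ ρ₀ (near 1 (s + 1 + 1) le_rfl (by omega) (not_lt.1 h)) hρ₀ (reads _ _ _)
      h₀).width_le (clip_markAt_fst _ le_rfl (by omega)) (s + 1) cs (by omega) hcs hjs
      (clip_markAt_snd _ (by omega) (by omega))
  have shift1 : ∀ i j, 1 ≤ i → i < j → j + 1 ≤ n → T j ≤ T i + 1 → T (j + 1) ≤ T (i + 1) + 1 := by
    intro i j hi hij hjn h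
    by_contra h'
    exact (H _ _ _ _ (near i j hi hij h) (far (i + 1) (j + 1) (by omega) (by omega) (not_le.1 h'))
      (reads _ _ _) (reads _ _ _)).near_succ i j hij (clip_markAt_fst _ hi (by omega))
      (clip_markAt_fst _ (by omega) (by omega)) (clip_markAt_snd _ hij (by omega))
      (clip_markAt_snd _ (by omega) (by omega))
  have shift2 : ∀ i j, 1 ≤ i → i < j → j + 1 ≤ n → T i + 1 < T j → T (i + 1) + 1 < T (j + 1) := by
    intro i j hi hij hjn h
    by_contra h'
    exact (H _ _ _ _ (near (i + 1) (j + 1) (by omega) (by omega) (not_lt.1 h')) (far i j hi hij h)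
      (reads _ _ _) (reads _ _ _)).far_succ i j hij (clip_markAt_fst _ hi (by omega))
      (clip_markAt_fst _ (by omega) (by omega)) (clip_markAt_snd _ hij (by omega))
      (clip_markAt_snd _ (by omega) (by omega))
  have rows : ∀ i, i + 1 + s + 1 ≤ n → T (i + 1 + s) ≤ T (i + 1) + 1 ∧
      T (i + 1) + 1 < T (i + 1 + s + 1) := by
    intro i
    induction i with
    | zero => exact fun _ => ⟨base1, base2⟩
    | succ i ih =>
      intro hn
      obtain ⟨h1, h2⟩ := ih (by omega)
      have h1' := shift1 (i + 1) (i + 1 + s) (by omega) (by omega) (by omega) h1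
      have h2' := shift2 (i + 1) (i + 1 + s + 1) (by omega) (by omega) (by omega) h2
      rw [show i + 1 + 1 + s = i + 1 + s + 1 by ring]
      exact ⟨h1', h2'⟩
  refine ⟨w, s, n, by omega, by omega, ?_, ?_, ?_, ?_, ?_⟩
  · exact fun i hi => hw_eq i _ (by omega) (hC.row i hi)
  · exact fun i hi his => hw_eq i _ (by omega) (hbl (i + 1) (by omega) (by omega))
  · rw [hw_eq s cs (by omega) hjs]
    exact hcs
  · intro i hi
    obtain ⟨h1, h2⟩ := rows i (by omega)
    refine (H _ _ _ _ (near (i + 1) (i + 1 + s) (by omega) (by omega) h1)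
      (far (i + 1) (i + 1 + s + 1) (by omega) (by omega) h2) (reads _ _ _) (reads _ _ _)).rel
      (i + 1) (i + 1 + s) _ _ _ _ (by omega) (clip_markAt_fst _ (by omega) (by omega))
      (clip_markAt_fst _ (by omega) (by omega)) (clip_markAt_snd _ (by omega) (by omega))
      (clip_markAt_snd _ (by omega) (by omega)) (hw i (by omega)) (hw (i + 1) (by omega)) ?_ ?_
    · rw [show i + 1 + s = i + s + 1 by ring]
      exact hw (i + s) (by omega)
    · rw [show i + 1 + s + 1 = i + s + 1 + 1 by ring]
      exact hw (i + s + 1) (by omega)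
  · obtain ⟨i, c, hc, hi, hin⟩ := hC.final
    have hi0 : 1 ≤ i := ((h₀.isSome i).1 (by rw [show l₀ i = _ from hi]; rfl)).1
    obtain ⟨i, rfl⟩ : ∃ i', i = i' + 1 := ⟨i - 1, by omega⟩
    refine ⟨i, by omega, ?_⟩
    rw [hw_eq i c (by omega) hi]
    exact hc

omit [Fintype C] in
/-- A tiling of width `s`, with events `s` to the unit of time, is correct. -/
theorem correct_of_tiling {u : List C} (hu : u ≠ [])
    (htail : ∀ i (h : i < u.length), 0 < i → ¬ D.start u[i]) (hblank : ¬ D.start D.blank)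
    {w : ℕ → C} {s n : ℕ} (hs : u.length ≤ s) (hsn : s + 1 < n)
    (hrow : ∀ i (h : i < u.length), w i = u[i])
    (hbl : ∀ i, u.length ≤ i → i < s → w i = D.blank) (hstart : D.start (w s))
    (hrel : ∀ i, i + s + 1 < n → D.rel (w i) (w (i + 1)) (w (i + s)) (w (i + s + 1)))
    (hfin : ∃ i, i + 1 < n ∧ D.final (w i)) {l₁ l₂ : ℕ → Option (C ⊕ Mark)}
    (h₁ : ∀ i j, i < j → l₁ i = some (.inr .fst) → l₁ j = some (.inr .near) → j ≤ i + s)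
    (h₂ : ∀ i j, i < j → l₂ i = some (.inr .fst) → l₂ j = some (.inr .far) → i + s < j) :
    Correct D n u (labels (clip n fun i => .inl (w (i - 1))) l₁ l₂) := by
  have hu0 : 0 < u.length := List.length_pos_iff.2 hu
  have hl : ∀ i c, labels (clip n fun i => .inl (w (i - 1))) l₁ l₂ 0 i = some (.inl c) ↔
      1 ≤ i ∧ i ≤ n ∧ w (i - 1) = c := by
    intro i c
    simp [labels, clip_eq_some]
  have hno : ∀ i, 0 < i → i < s → ¬ D.start (w i) := by
    intro i hi his
    rcases lt_or_ge i u.length with h | h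
    · rw [hrow i h]
      exact htail i h hi
    · rw [hbl i h his]
      exact hblank
  constructor
  · intro i hi
    exact (hl _ _).2 ⟨by omega, by omega, hrow i hi⟩
  · refine ⟨s + 1, by omega, ⟨_, hstart, (hl _ _).2 ⟨by omega, by omega, rfl⟩⟩, by omega,
      fun i hi his => (hl _ _).2 ⟨by omega, by omega, hbl _ (by omega) (by omega)⟩⟩
  · exact fun i hi hin => ⟨_, (hl _ _).2 ⟨hi, hin, rfl⟩⟩
  · obtain ⟨i, hi, hf⟩ := hfin
    exact ⟨i + 1, _, hf, (hl _ _).2 ⟨by omega, by omega, rfl⟩, by omega⟩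
  · intro i j hij a1 a2 a3 a4
    have := h₁ i j hij a1 a3
    have := h₂ (i + 1) (j + 1) (by omega) a2 a4
    omega
  · intro i j hij a1 a2 a3 a4
    have := h₂ i j hij a1 a3
    have := h₁ (i + 1) (j + 1) (by omega) a2 a4
    omega
  · intro a1 j c hj hc hjc a2
    obtain ⟨-, -, rfl⟩ := (hl _ _).1 hjc
    have := h₁ 1 (j + 1) (by omega) a1 a2
    exact hno (j - 1) (by omega) (by omega) hc
  · intro a1 j c hj hc hjc hk a2
    have := h₂ 1 j hj a1 a2
    obtain ⟨c', hc', hk'⟩ := hk (1 + s) (by omega) (by omega)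
    obtain ⟨-, -, rfl⟩ := (hl _ _).1 hk'
    rw [Nat.add_sub_cancel_left] at hc'
    exact hc' hstart
  · intro i j x y z t hij a1 a2 a3 a4 hx hy hz ht
    have b1 := h₁ i j hij a1 a3
    have b2 := h₂ i (j + 1) (by omega) a2 a4
    obtain rfl : j = i + s := by omega
    obtain ⟨hi1, -, rfl⟩ := (hl _ _).1 hx
    obtain ⟨-, -, rfl⟩ := (hl _ _).1 hy
    obtain ⟨-, -, rfl⟩ := (hl _ _).1 hz
    obtain ⟨-, htn, rfl⟩ := (hl _ _).1 ht
    have := hrel (i - 1) (by omega)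
    rw [show i - 1 + 1 = i + 1 - 1 by omega, show i - 1 + s = i + s - 1 by omega,
      show i + s - 1 + 1 = i + s + 1 - 1 by omega] at this
    exact this

theorem timeGrid_div {s : ℕ} (hs : 0 < s) (n : ℕ) :
    TimeGrid n (fun i => (i : ℝ≥0) / s) where
  zero := by simp
  lt i j hij _ := by
    have : (0 : ℝ≥0) < s := by exact_mod_cast hs
    have : (i : ℝ≥0) < j := by exact_mod_cast hij
    gcongr

theorem div_le_div_add_one_iff {s : ℕ} (hs : 0 < s) (i j : ℕ) :
    (j : ℝ≥0) / s ≤ (i : ℝ≥0) / s + 1 ↔ j ≤ i + s := by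
  have : (0 : ℝ≥0) < s := by exact_mod_cast hs
  rw [div_add_one this.ne', div_le_div_iff_of_pos_right this]
  exact_mod_cast Iff.rfl

/-- The specification holds of the automaton if and only if the tiling problem is solvable. -/
theorem modelsSync_iff_hasTiling {u : List C} (hu : u ≠ [])
    (htail : ∀ i (h : i < u.length), 0 < i → ¬ D.start u[i]) (hblank : ¬ D.start D.blank) :
    ModelsSync (marker e).language (existsForall (bodyF e D u)) ↔ D.HasTiling u := by
  rw [modelsSync_existsForall]
  constructor
  · rintro ⟨ρ₀, hρ₀, H⟩
    have h0 : ¬ ρ₀.HasTime 0 := by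
      have := H ρ₀ hρ₀ (fun _ => Iff.rfl) ρ₀ hρ₀ (fun _ => Iff.rfl)
      exact fun h => this.2.1 ⟨0, ρ₀, rfl, h⟩
    obtain ⟨n, T, hT, htime⟩ := exists_timeGrid ρ₀ h0
    obtain ⟨l₀, h₀⟩ := exists_reads e hρ₀ htime
    refine hasTiling_of_correct e D hu htail hblank hT hρ₀ h₀ fun l₁ l₂ ρ₁ ρ₂ m₁ m₂ h₁ h₂ => ?_
    rw [← (context_assign hT h₀ h₁ h₂).satAt_bodyF]
    refine ⟨Nat.zero_le n, ?_⟩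
    rw [hT.zero]
    exact H ρ₁ m₁ (fun t => (h₀.time t).trans (h₁.time t).symm) ρ₂ m₂
      (fun t => (h₀.time t).trans (h₂.time t).symm)
  · rintro ⟨w, s, n, hs, hsn, hrow, hbl, hstart, hrel, hfin⟩
    have hs0 : 0 < s := (List.length_pos_iff.2 hu).trans_le hs
    have hT := timeGrid_div hs0 n
    have h₀ := gridTrace_reads e hT fun i => .inl (w (i - 1))
    refine ⟨gridTrace e hT fun i => .inl (w (i - 1)), gridTrace_cells_mem e hT _,
      fun ρ₁ m₁ t₁ ρ₂ m₂ t₂ => ?_⟩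
    obtain ⟨l₁, h₁⟩ := exists_reads e m₁ fun t => (t₁ t).symm.trans (h₀.time t)
    obtain ⟨l₂, h₂⟩ := exists_reads e m₂ fun t => (t₂ t).symm.trans (h₀.time t)
    have hC := correct_of_tiling D hu htail hblank hs hsn hrow hbl hstart hrel hfin
      (fun i j hij hi hj =>
        (div_le_div_add_one_iff hs0 i j).1 ((h₁.near_far e m₁ hT hij hi).1 hj))
      (fun i j hij hi hj => by
        have := (h₂.near_far e m₂ hT hij hi).2 hj
        rw [← not_le, div_le_div_add_one_iff hs0] at this
        omega)
    have := ((context_assign hT h₀ h₁ h₂).satAt_bodyF D u).2 hC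
    simpa [hT.zero] using this.2

end Equivalence

/-! ### Computability of the reduction -/

open Turing.PartrecToTM2 (K' Γ')

instance : Finite K' :=
  Finite.of_surjective (α := Fin 4) ![.main, .rev, .aux, .stack] fun x => by
    cases x
    exacts [⟨0, rfl⟩, ⟨1, rfl⟩, ⟨2, rfl⟩, ⟨3, rfl⟩]

/-- A column of an initial configuration, where all stacks but the main one are empty. -/
def inputCell {Q : Type} (q : Q) (start : Bool) (o : Option Γ') : Cell Q K' Γ' :=
  ⟨q, start, fun κ => match κ with
    | .main => o
    | _ => none⟩

/-- The columns of an initial configuration, followed by a blank one. -/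
def inputRow {Q : Type} (q : Q) (k : ℕ) : List (Cell Q K' Γ') :=
  inputCell q true (some .bit0) :: (List.replicate k (inputCell q false (some .bit0)) ++
    [inputCell q false (some .bit1), inputCell q false (some .cons), inputCell q false none])

theorem columns_inputStacks {Q : Type} (q : Q) (k : ℕ) :
    columns (q, inputStacks k) (k + 4) = inputRow q k := by
  have hcol : ∀ j, column (q, inputStacks k) j = inputCell q (decide (j = 0))
      (List.replicate (k + 1) Γ'.bit0 ++ [Γ'.bit1, Γ'.cons])[j]? := by
    intro j
    simp only [column, inputCell, Cell.mk.injEq, true_and]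
    funext κ
    cases κ <;> rfl
  refine List.ext_getElem (by simp [columns, inputRow]) fun j h1 h2 => ?_
  have hj : j < k + 4 := by simpa [columns] using h1
  simp only [columns, List.getElem_map, List.getElem_range, hcol, inputRow]
  cases j with
  | zero => simp [List.replicate_succ]
  | succ j =>
    rw [List.getElem_cons_succ, List.replicate_succ, List.cons_append, List.getElem?_cons_succ]
    rcases lt_or_ge j k with h | h
    · rw [List.getElem_append_left (by simpa using h), List.getElem?_append_left (by simpa using h)]
      simp [h]
    · obtain ⟨i, rfl⟩ := Nat.exists_eq_add_of_le h
      rw [List.getElem_append_right (by simp), List.getElem?_append_right (by simp)]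
      have hi : i < 3 := by omega
      interval_cases i <;> simp

section Codes

variable {Q : Type} {m : ℕ} [Fintype (Cell Q K' Γ')] (e : Cell Q K' Γ' ⊕ Mark ≃ Fin m)
  (D : TileSystem (Cell Q K' Γ')) (q : Q)

theorem prefixF_code_cons : ∃ g : Cell Q K' Γ' → ℕ → ℕ, (∀ c, Primrec (g c)) ∧
    ∀ c u, (prefixF e D (c :: u)).code = g c (prefixF e D u).code := by
  refine ⟨fun c r => Nat.pair 5 (Nat.pair TimeInterval.full.code (Nat.pair
    (QFree.bot : QFree m).code (Nat.pair 3 (Nat.pair (cellF e c).code r)))), fun c => ?_,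
    fun c u => rfl⟩
  have key : ∀ {f : ℕ → ℕ} (a : ℕ), Primrec f → Primrec fun n => Nat.pair a (f n) :=
    fun a hf => Primrec₂.natPair.comp (.const a) hf
  exact key _ (key _ (key _ (key _ (key _ .id))))

theorem primrec_prefixF_code : Primrec fun k => (prefixF e D (inputRow q k)).code := by
  obtain ⟨g, hg, hcode⟩ := prefixF_code_cons e D
  have : ∀ c k u, (prefixF e D (List.replicate k c ++ u)).code =
      (g c)^[k] (prefixF e D u).code := by
    intro c k u
    induction k with
    | zero => rfl
    | succ k ih =>
      rw [List.replicate_succ, List.cons_append, hcode, ih, Function.iterate_succ_apply']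
  simp only [inputRow, hcode, this]
  exact (hg _).comp (Primrec.nat_iterate .id (.const _) ((hg _).comp .snd).to₂)

/-- The instances of the reduction for the pattern `∃∀∀`. -/
noncomputable def instanceEA (k : ℕ) : Instance :=
  ⟨m, marker e, existsForall (bodyF e D (inputRow q k))⟩

/-- The instances of the reduction for the pattern `∀∃∃`. -/
noncomputable def instanceAE (k : ℕ) : Instance :=
  ⟨m, marker e, forallExists (.neg (bodyF e D (inputRow q k)))⟩

theorem computable_instanceEA_code : Computable fun k => (instanceEA e D q k).code := by
  have key : ∀ {f : ℕ → ℕ} (a : ℕ), Primrec f → Primrec fun n => Nat.pair a (f n) :=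
    fun a hf => Primrec₂.natPair.comp (.const a) hf
  have body : Primrec fun k => (bodyF e D (inputRow q k)).code :=
    key 3 (Primrec₂.natPair.comp (primrec_prefixF_code e D q) (.const (mainF e D).code))
  exact (key m (key (marker e).code (key 0 (key 0 (key 1 (key 1 (key 1 (key 2
    (key 2 body))))))))).to_comp

theorem computable_instanceAE_code : Computable fun k => (instanceAE e D q k).code := by
  have key : ∀ {f : ℕ → ℕ} (a : ℕ), Primrec f → Primrec fun n => Nat.pair a (f n) :=
    fun a hf => Primrec₂.natPair.comp (.const a) hf
  have body : Primrec fun k => (bodyF e D (inputRow q k)).code :=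
    key 3 (Primrec₂.natPair.comp (primrec_prefixF_code e D q) (.const (mainF e D).code))
  exact (key m (key (marker e).code (key 1 (key 0 (key 0 (key 1 (key 0 (key 2
    (key 2 (key 4 body)))))))))).to_comp

theorem marker_restricted {C : Type} [Fintype C] (e : C ⊕ Mark ≃ Fin m) {φ : Formula m}
    (h : φ.body.IsLTL) : (⟨m, marker e, φ⟩ : Instance).IsRestricted :=
  ⟨marker_oneClock e, marker_nonSingular e, marker_resetOnTesting e, marker_hasStutterLoops e, h⟩

theorem erase_vars_eq_empty {ψ : QFree m} (h : ψ.vars ⊆ Finset.range 3) :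
    ((ψ.vars.erase 2).erase 1).erase 0 = ∅ := by
  refine Finset.eq_empty_of_forall_notMem fun π hπ => ?_
  simp only [Finset.mem_erase] at hπ
  have := Finset.mem_range.1 (h hπ.2.2.2)
  omega

theorem instanceEA_mem (k : ℕ) : (instanceEA e D q k).spec.Closed ∧
    (instanceEA e D q k).IsRestricted ∧
    (instanceEA e D q k).spec.pattern = [Quant.ex, Quant.all, Quant.all] := by
  have h := bodyF_plain e D (inputRow q k)
  exact ⟨⟨erase_vars_eq_empty h.2, by simp [instanceEA, existsForall, Formula.boundVars]⟩,
    marker_restricted e h.1, rfl⟩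

theorem instanceAE_mem (k : ℕ) : (instanceAE e D q k).spec.Closed ∧
    (instanceAE e D q k).IsRestricted ∧
    (instanceAE e D q k).spec.pattern = [Quant.all, Quant.ex, Quant.ex] := by
  have h := (bodyF_plain e D (inputRow q k)).neg
  exact ⟨⟨erase_vars_eq_empty h.2, by simp [instanceAE, forallExists, Formula.boundVars]⟩,
    marker_restricted e h.1, rfl⟩

variable (M : StackMachine Q K' Γ')

theorem instanceEA_holds_iff (k : ℕ) :
    (instanceEA e (M.tiles q) q k).HoldsSync ↔ M.Halts (q, inputStacks k) := by
  have hlen : ∀ κ, ((q, inputStacks k).2 κ).length ≤ k + 4 := by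
    intro κ
    cases κ <;> simp [inputStacks, Turing.PartrecToTM2.K'.elim]
  rw [← hasTiling_columns_iff M (c := (q, inputStacks k)) (by omega) hlen, columns_inputStacks]
  refine modelsSync_iff_hasTiling e (M.tiles q) (by simp [inputRow]) (fun i hi hi0 => ?_)
    (by simp [StackMachine.tiles])
  simp only [← columns_inputStacks, columns, List.getElem_map, List.getElem_range]
  simp [StackMachine.tiles, column, hi0.ne']

theorem instanceAE_holds_iff (k : ℕ) :
    (instanceAE e (M.tiles q) q k).HoldsSync ↔ ¬ M.Halts (q, inputStacks k) := by
  rw [← instanceEA_holds_iff e q M]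
  exact modelsSync_forallExists_neg _ (bodyF_guarded e _ _) (bodyF_plain e _ _).2

end Codes

theorem SyncModelCheckingDecidable.mono {C C' : Instance → Prop} (h : ∀ x, C x → C' x) :
    SyncModelCheckingDecidable C' → SyncModelCheckingDecidable C :=
  fun ⟨D, hD, hC⟩ => ⟨D, hD, fun x hx => hC x (h x hx)⟩

theorem SyncModelCheckingDecidable.computablePred {C : Instance → Prop}
    (h : SyncModelCheckingDecidable C) {f : ℕ → Instance} (hf : Computable fun k => (f k).code)
    (hC : ∀ k, C (f k)) : ComputablePred fun k => (f k).HoldsSync := by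
  obtain ⟨D, hD, hx⟩ := h
  obtain ⟨d, hd, rfl⟩ := ComputablePred.computable_iff.1 hD
  refine ComputablePred.computable_iff.2 ⟨fun k => d (f k).code, hd.comp hf, ?_⟩
  funext k
  exact propext (hx _ (hC k)).symm

theorem restricted_undecidable :
    ¬ SyncModelCheckingDecidable (fun x => x.spec.Closed ∧ x.IsRestricted ∧
      x.spec.pattern = [Quant.ex, Quant.all, Quant.all]) ∧
    ¬ SyncModelCheckingDecidable (fun x => x.spec.Closed ∧ x.IsRestricted ∧
      x.spec.pattern = [Quant.all, Quant.ex, Quant.ex]) := by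
  obtain ⟨Q, _, M, q, hM⟩ := exists_undecidable_stackMachine
  let _ : Fintype (Cell Q K' Γ') := Fintype.ofFinite _
  obtain ⟨m, ⟨e⟩⟩ := Finite.exists_equiv_fin (Cell Q K' Γ' ⊕ Mark)
  constructor <;> intro h <;> refine hM ?_
  · exact (h.computablePred (computable_instanceEA_code e (M.tiles q) q)
      (instanceEA_mem e _ q)).of_eq (instanceEA_holds_iff e q M)
  · exact (h.computablePred (computable_instanceAE_code e (M.tiles q) q)
      (instanceAE_mem e _ q)).not.of_eq fun k => by
        rw [instanceAE_holds_iff e q M, not_not]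

end HyperMTL

theorem mainTheorem2 :
    ¬ HyperMTL.SyncModelCheckingDecidable
        (fun x => x.spec.Closed ∧ x.spec.IsExistsForall) ∧
    ¬ HyperMTL.SyncModelCheckingDecidable
        (fun x => x.spec.Closed ∧ x.spec.IsForallExists) ∧
    ¬ HyperMTL.SyncModelCheckingDecidable
        (fun x => x.spec.Closed ∧ x.IsRestricted ∧
          x.spec.pattern = [HyperMTL.Quant.ex, HyperMTL.Quant.all, HyperMTL.Quant.all]) ∧
    ¬ HyperMTL.SyncModelCheckingDecidable
        (fun x => x.spec.Closed ∧ x.IsRestricted ∧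
          x.spec.pattern = [HyperMTL.Quant.all, HyperMTL.Quant.ex, HyperMTL.Quant.ex]) := by
  obtain ⟨hEA, hAE⟩ := HyperMTL.restricted_undecidable
  exact ⟨fun h => hEA (h.mono fun x hx => ⟨hx.1, 1, 2, hx.2.2⟩),
    fun h => hAE (h.mono fun x hx => ⟨hx.1, 1, 2, hx.2.2⟩), hEA, hAE⟩
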